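/- Let $\mathbb K$ be $\mathbb R$ or $\mathbb C$. A modulus on a vector space $E$ over $\mathbb K$ is a map $m\colon E\to E$ with $m\circ m=m$ such that (i) $m(\alpha f)=|\alpha|\,m(f)$ for all $\alpha\in\mathbb K$, $f\in E$; (ii) $m\bigl(m(m(f)+m(g))-m(f+g)\bigr)=m(f)+m(g)-m(f+g)$ for all $f,g\in E$; and (iii) $E$ is the $\mathbb K$-linear hull of $m(E)$. It is Archimedean if, for $f,g\in E$, the equalities $m\bigl(m(g)-n\,m(f)\bigr)=m(g)-n\,m(f)$ for all integers $n\ge 1$ imply $f=0$. An Archimedean vector lattice over $\mathbb K$ is a vector space over $\mathbb K$ with an Archimedean modulus, written $|f|:=m(f)$. It is ordered by $f\le g\iff |g-f|=g-f$, and its real part is $E_\rho:=m(E)-m(E)$, with the restricted modulus. A vector lattice homomorphism over $\mathbb K$ is a $\mathbb K$-linear map $T$ with $T(|f|)=|T(f)|$ for all $f$; it is an isomorphism if it is bijective. Let $E$ be an Archimedean vector lattice over $\mathbb R$. A vector lattice complexification of $E$ is a pair $(C,\phi)$ such that $C$ is an Archimedean vector lattice over $\mathbb C$, $\phi\colon E\to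 C_\rho$ is an injective vector lattice homomorphism over $\mathbb R$, and for every Archimedean vector lattice $F$ over $\mathbb C$ and every vector lattice homomorphism $T\colon E\to F_\rho$ over $\mathbb R$ there is a unique vector lattice homomorphism $S\colon C\to F$ over $\mathbb C$ with $S\circ\phi=T$. An Archimedean vector lattice $M$ over $\mathbb R$ is square mean complete if $f\boxplus g:=\sup\{f\cos\theta+g\sin\theta:\theta\in[0,2\pi]\}$ exists in $M$ for all $f,g\in M$. A square mean completion of $E$ is a pair $(M,\phi)$ such that $M$ is a square mean complete Archimedean vector lattice over $\mathbb R$, $\phi\colon E\to M$ is an injective vector lattice homomorphism, and for every square mean complete Archimedean vector lattice $F$ over $\mathbb R$ and every vector lattice homomorphism $T\colon E\to F$ there is a unique vector lattice homomorphism $S\colon M\to F$ with $S\circ\phi=T$. Theorem 3.3. Let $E$ be an Archimedean vector lattice over $\mathbb R$. 1. $E$ has a vector lattice complexification. 2. It is unique up to vector lattice isomorphism: if $(C_1,\phi_1)$ and $(C_2,\phi_2)$ are vector lattice complexifications of $E$, then there is a unique vector lattice isomorphism $\gamma\colon C_1\to C_2$ over $\mathbb C$ with $\gamma\circ\phi_1=\phi_2$.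 3. $E$ has a square mean completion. For every square mean completion $(M,\phi)$ of $E$, the vector space complexification $M\oplus iM$ with the modulus $|f+ig|=f\boxplus g$, together with $\phi$ regarded as a map into $M\oplus iM$, is a vector lattice complexification of $E$. -/

import Mathlib

universe u v w

noncomputable section

/-! ### Moduli and Archimedean vector lattices over `ℝ` or `ℂ` -/

/-- A modulus (in the sense of Mittelmeyer and Wolff) on a vector space over `𝕜`, where
`𝕜` is `ℝ` or `ℂ`. -/
structure IsModulus (𝕜 : Type*) [RCLike 𝕜] {E : Type*} [AddCommGroup E] [Module 𝕜 E]
    (m : E → E) : Prop where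
  idem : ∀ f, m (m f) = m f
  smul : ∀ (a : 𝕜) (f : E), m (a • f) = ((‖a‖ : ℝ) : 𝕜) • m f
  add : ∀ f g, m (m (m f + m g) - m (f + g)) = m f + m g - m (f + g)
  span : Submodule.span 𝕜 (Set.range m) = ⊤

/-- An Archimedean modulus. A vector space over `𝕜` together with an Archimedean modulus is
an Archimedean vector lattice over `𝕜`. -/
structure IsArchimedeanModulus (𝕜 : Type*) [RCLike 𝕜] {E : Type*} [AddCommGroup E]
    [Module 𝕜 E] (m : E → E) : Prop extends IsModulus 𝕜 m where
  arch : ∀ f g, (∀ n : ℕ, 0 < n → m (m g - n • m f) = m g - n • m f) → f = 0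

/-- The real part `E_ρ = m(E) - m(E)`. -/
def modulusRealPart {E : Type*} [AddCommGroup E] (m : E → E) : Set E :=
  {x | ∃ f g, x = m f - m g}

/-- The order on a space with modulus `m`: `f ≤ g` means that `g - f` is in the positive cone
`{h | m h = h}`, which is `m(E)` since `m` is idempotent. -/
@[reducible]
def modulusLE {E : Type*} [AddCommGroup E] (m : E → E) : LE E :=
  ⟨fun f g => m (g - f) = g - f⟩

/-- A `𝕜`-linear map is a vector lattice homomorphism if it commutes with the moduli. -/
def IsVLHom (𝕜 : Type*) [RCLike 𝕜] {E F : Type*} [AddCommGroup E] [Module 𝕜 E]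
    [AddCommGroup F] [Module 𝕜 F] (mE : E → E) (mF : F → F) (T : E →ₗ[𝕜] F) : Prop :=
  ∀ f, T (mE f) = mF (T f)

/-- The real-linear map `T` takes its values in the real part of the complex vector lattice
`F`, and is a vector lattice `ℝ`-homomorphism from `E` to that real part, whose modulus is
the restriction of the modulus of `F`. -/
structure IsRealPartVLHom {E F : Type*} [AddCommGroup E] [Module ℝ E]
    [AddCommGroup F] [Module ℂ F] (mE : E → E) (mF : F → F) (T : E →ₗ[ℝ] F) : Prop where
  mem_realPart : ∀ f, T f ∈ modulusRealPart mF
  hom : IsVLHom ℝ mE mF T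

/-! ### Vector lattice complexifications -/

/-- `(C, φ)` is a vector lattice complexification of the real vector lattice `E`. The universe
of the targets `F` in the universal property is the last universe parameter. -/
structure IsVLComplexification {E : Type u} [AddCommGroup E] [Module ℝ E]
    {C : Type v} [AddCommGroup C] [Module ℂ C]
    (mE : E → E) (mC : C → C) (φ : E →ₗ[ℝ] C) : Prop where
  modulus : IsArchimedeanModulus ℂ mC
  hom : IsRealPartVLHom mE mC φ
  injective : Function.Injective φ
  universal : ∀ (F : Type w) [AddCommGroup F] [Module ℂ F] (mF : F → F),
    IsArchimedeanModulus ℂ mF → ∀ T : E →ₗ[ℝ] F, IsRealPartVLHom mE mF T →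
      ∃! S : C →ₗ[ℂ] F, IsVLHom ℂ mC mF S ∧ ∀ f, S (φ f) = T f

/-! ### Square means and square mean completions -/

/-- `s = sup {f cos θ + g sin θ : θ ∈ [0, 2π]}` in the real vector lattice `E`. -/
def IsBoxPlus {E : Type*} [AddCommGroup E] [Module ℝ E] (m : E → E) (f g s : E) : Prop :=
  @IsLUB E (modulusLE m)
    ((fun θ : ℝ => Real.cos θ • f + Real.sin θ • g) '' Set.Icc 0 (2 * Real.pi)) s

/-- A real vector lattice is square mean complete if all the suprema
`f ⊞ g = sup {f cos θ + g sin θ : θ ∈ [0, 2π]}` exist in it. -/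
def IsSquareMeanComplete {E : Type*} [AddCommGroup E] [Module ℝ E] (m : E → E) : Prop :=
  ∀ f g, ∃ s, IsBoxPlus m f g s

open Classical in
/-- The element `f ⊞ g` (and `0` if the supremum does not exist). -/
def boxPlus {E : Type*} [AddCommGroup E] [Module ℝ E] (m : E → E) (f g : E) : E :=
  if h : ∃ s, IsBoxPlus m f g s then h.choose else 0

/-- `(M, φ)` is a square mean completion of the real vector lattice `E`. The universe of the
targets `F` in the universal property is the last universe parameter. -/
structure IsSquareMeanCompletion {E : Type u} [AddCommGroup E] [Module ℝ E]
    {M : Type v} [AddCommGroup M] [Module ℝ M]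
    (mE : E → E) (mM : M → M) (φ : E →ₗ[ℝ] M) : Prop where
  modulus : IsArchimedeanModulus ℝ mM
  complete : IsSquareMeanComplete mM
  hom : IsVLHom ℝ mE mM φ
  injective : Function.Injective φ
  universal : ∀ (F : Type w) [AddCommGroup F] [Module ℝ F] (mF : F → F),
    IsArchimedeanModulus ℝ mF → IsSquareMeanComplete mF →
    ∀ T : E →ₗ[ℝ] F, IsVLHom ℝ mE mF T →
      ∃! S : M →ₗ[ℝ] F, IsVLHom ℝ mM mF S ∧ ∀ f, S (φ f) = T f

/-! ### The vector space complexification `V ⊕ iV` -/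

/-- The elements `re + i im` of the vector space complexification `V ⊕ iV` of `V`. -/
@[ext]
structure VSComplexification (V : Type u) : Type u where
  re : V
  im : V

namespace VSComplexification

section

variable {V : Type u} [AddCommGroup V]

instance : Zero (VSComplexification V) := ⟨⟨0, 0⟩⟩
instance : Add (VSComplexification V) := ⟨fun x y => ⟨x.re + y.re, x.im + y.im⟩⟩
instance : Neg (VSComplexification V) := ⟨fun x => ⟨-x.re, -x.im⟩⟩

@[simp] theorem zero_re : (0 : VSComplexification V).re = 0 := rfl
@[simp] theorem zero_im : (0 : VSComplexification V).im = 0 := rfl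
@[simp] theorem add_re (x y : VSComplexification V) : (x + y).re = x.re + y.re := rfl
@[simp] theorem add_im (x y : VSComplexification V) : (x + y).im = x.im + y.im := rfl
@[simp] theorem neg_re (x : VSComplexification V) : (-x).re = -x.re := rfl
@[simp] theorem neg_im (x : VSComplexification V) : (-x).im = -x.im := rfl

instance : AddCommGroup (VSComplexification V) where
  add_assoc x y z := by ext <;> simp [add_assoc]
  zero_add x := by ext <;> simp
  add_zero x := by ext <;> simp
  add_comm x y := by ext <;> simp [add_comm]
  neg_add_cancel x := by ext <;> simp
  nsmul := nsmulRec
  zsmul := zsmulRec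

end

variable {V : Type u} [AddCommGroup V] [Module ℝ V]

instance : SMul ℂ (VSComplexification V) :=
  ⟨fun c x => ⟨c.re • x.re - c.im • x.im, c.re • x.im + c.im • x.re⟩⟩

@[simp] theorem smul_re (c : ℂ) (x : VSComplexification V) :
    (c • x).re = c.re • x.re - c.im • x.im := rfl
@[simp] theorem smul_im (c : ℂ) (x : VSComplexification V) :
    (c • x).im = c.re • x.im + c.im • x.re := rfl

instance : Module ℂ (VSComplexification V) where
  one_smul x := by ext <;> simp
  mul_smul a b x := by ext <;> simp <;> module
  smul_zero a := by ext <;> simp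
  smul_add a x y := by ext <;> simp <;> module
  add_smul a b x := by ext <;> simp <;> module
  zero_smul x := by ext <;> simp

/-- The natural embedding of `V` into `V ⊕ iV`, as a real-linear map. -/
def ofReal : V →ₗ[ℝ] VSComplexification V where
  toFun f := ⟨f, 0⟩
  map_add' f g := by ext <;> simp
  map_smul' r f := by
    rw [RingHom.id_apply, ← Complex.coe_smul]
    ext <;> simp only [smul_re, smul_im] <;> simp

/-- The map `f + ig ↦ f ⊞ g` on `V ⊕ iV`. -/
def modulus (m : V → V) (z : VSComplexification V) : VSComplexification V :=
  ofReal (boxPlus m z.re z.im)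

end VSComplexification

end

/-!
Everything rests on two facts about Archimedean vector lattices.

The first is that the modulus of an Archimedean vector lattice `F` over `ℂ` is a square mean:
`|f + ig| = f ⊞ g` for `f`, `g` in the real part `F_ρ` (`isBoxPlus_of_triangle`). Put
`u = |f| + |g|`. For a complex number `a + ib` the modulus of `(a + ib)u` is known by homogeneity,
and by the triangle inequality `|f + ig|` differs from it by at most `|f - au| + |g - bu|`.
Up to twice that error `|f + ig|` therefore dominates `f`, and hence every rotation
`f cos θ + g sin θ`, and up to the same error it lies below every upper bound of the rotations.
Since no nonzero positive element lies below all the errors, `a, b ∈ ℝ`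
(`nonpos_of_le_abs_sub_smul_add`), the error disappears. Consequently `F_ρ` is square mean complete.
Conversely, over a square mean complete `M` the map `f + ig ↦ f ⊞ g` is an Archimedean modulus on
`M ⊕ iM`. A square mean is the uniform limit of finite suprema (`isBoxPlus_iff_boxApprox`), so
vector lattice homomorphisms preserve it, and homomorphisms `M → F_ρ` correspond to homomorphisms
`M ⊕ iM → F`. This turns the universal property of a square mean completion into that of a
complexification (`IsSquareMeanCompletion.isVLComplexification`).

The second is the existence of a square mean completion. The relatively uniformly Cauchy
sequences in `E`, modulo null sequences, form an Archimedean vector lattice that contains `E` and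
is square mean complete, since the finite approximations of a square mean form a Cauchy sequence.
In it, `E` generates a sublattice that is closed under square means. A homomorphism `T` from `E`
into a square mean complete `F` extends to this hull although `F` need not be relatively uniformly
complete: every element of the hull is represented by a Cauchy sequence whose image under `T`
converges in `F`, by induction on the construction of that element (`exists_isRULimit`). The
extension is unique because homomorphisms preserve square means.
-/

noncomputable section

/-! ### Real vector lattices: moduli versus lattice orders -/

/-- Archimedean real vector lattices, as a property of a real vector space with a lattice structure.
The modulus is then the absolute value `|f| = f ⊔ -f`. -/
class ArchVL (E : Type*) [AddCommGroup E] [Lattice E] [Module ℝ E] : Prop extends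
    IsOrderedAddMonoid E, PosSMulMono ℝ E where
  arch : ∀ f g : E, (∀ n : ℕ, n • |f| ≤ g) → f = 0

section Modulus

variable {𝕜 : Type*} [RCLike 𝕜] {E : Type*} [AddCommGroup E] [Module 𝕜 E] {m : E → E}

namespace IsModulus

theorem map_zero (hm : IsModulus 𝕜 m) : m 0 = 0 := by
  have := hm.smul 0 0
  simpa using this

/-- The cone `{h | m h = h}` is closed under addition. -/
theorem map_add_eq (hm : IsModulus 𝕜 m) {f g : E} (hf : m f = f) (hg : m g = g) :
    m (f + g) = f + g := by
  have h := hm.add f g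
  rw [hf, hg, sub_self, hm.map_zero] at h
  exact (sub_eq_zero.mp h.symm).symm

theorem map_nonneg_smul (hm : IsModulus 𝕜 m) {r : ℝ} (hr : 0 ≤ r) {f : E} (hf : m f = f) :
    m ((r : 𝕜) • f) = (r : 𝕜) • f := by
  rw [hm.smul, hf, RCLike.norm_ofReal, abs_of_nonneg hr]

theorem map_neg (hm : IsModulus 𝕜 m) (f : E) : m (-f) = m f := by
  have := hm.smul (-1) f
  simpa using this

/-- The triangle inequality. -/
theorem triangle (hm : IsModulus 𝕜 m) (f g : E) :
    m (m f + m g - m (f + g)) = m f + m g - m (f + g) := by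
  have h := hm.add f g
  rwa [hm.map_add_eq (hm.idem f) (hm.idem g)] at h

end IsModulus

end Modulus

section RealModulus

variable {E : Type*} [AddCommGroup E] [Module ℝ E] {m : E → E}

namespace IsModulus

theorem map_smul_real (hm : IsModulus ℝ m) {r : ℝ} (hr : 0 ≤ r) {f : E} (hf : m f = f) :
    m (r • f) = r • f := by
  simpa using hm.map_nonneg_smul hr hf

theorem smul_real (hm : IsModulus ℝ m) (r : ℝ) (f : E) : m (r • f) = |r| • m f := by
  simpa using hm.smul r f

/-- In the real case every element is a difference of positive ones. -/
theorem exists_sub (hm : IsModulus ℝ m) (f : E) : ∃ p q, m p = p ∧ m q = q ∧ f = p - q := by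
  have hf : f ∈ Submodule.span ℝ (Set.range m) := by rw [hm.span]; trivial
  induction hf using Submodule.span_induction with
  | mem x hx =>
    obtain ⟨y, rfl⟩ := hx
    exact ⟨m y, 0, hm.idem y, hm.map_zero, by simp⟩
  | zero => exact ⟨0, 0, hm.map_zero, hm.map_zero, by simp⟩
  | add x y _ _ hx hy =>
    obtain ⟨p, q, hp, hq, rfl⟩ := hx
    obtain ⟨p', q', hp', hq', rfl⟩ := hy
    exact ⟨p + p', q + q', hm.map_add_eq hp hp', hm.map_add_eq hq hq', by abel⟩
  | smul a x _ hx =>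
    obtain ⟨p, q, hp, hq, rfl⟩ := hx
    rcases le_total 0 a with ha | ha
    · exact ⟨a • p, a • q, hm.map_smul_real ha hp, hm.map_smul_real ha hq, smul_sub _ _ _⟩
    · refine ⟨(-a) • q, (-a) • p, hm.map_smul_real (by linarith) hq,
        hm.map_smul_real (by linarith) hp, by module⟩

theorem map_sub_self (hm : IsModulus ℝ m) (f : E) : m (m f - f) = m f - f := by
  obtain ⟨p, q, hp, hq, rfl⟩ := hm.exists_sub f
  have h := hm.triangle (p - q) q
  rw [sub_add_cancel, hp, hq] at h
  rwa [sub_sub_eq_add_sub]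

theorem map_add_self (hm : IsModulus ℝ m) (f : E) : m (m f + f) = m f + f := by
  have h := hm.map_sub_self (-f)
  rwa [hm.map_neg, sub_neg_eq_add] at h

/-- Together with `map_sub_self` and `map_add_self` this says that `m f` is the supremum of `f` and
`-f` in the order `f ≤ g ↔ m (g - f) = g - f`. -/
theorem map_le (hm : IsModulus ℝ m) {f h : E} (h₁ : m (h - f) = h - f)
    (h₂ : m (h + f) = h + f) : m (h - m f) = h - m f := by
  -- `2 f = (h + f) - (h - f)`, so the triangle inequality gives `2 m f ≤ 2 h`.
  have h3 := hm.triangle (h + f) (-(h - f))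
  rw [hm.map_neg, h₁, h₂] at h3
  have e : h + f + -(h - f) = (2 : ℝ) • f := by rw [two_smul]; abel
  rw [e, hm.smul_real, abs_of_pos two_pos] at h3
  have h4 := hm.map_smul_real (r := 1 / 2) (by norm_num) h3
  have e2 : (1 / 2 : ℝ) • (h + f + (h - f) - (2 : ℝ) • m f) = h - m f := by module
  rwa [e2] at h4

/-- The order defined by a real modulus. -/
@[reducible]
def partialOrder (hm : IsModulus ℝ m) : PartialOrder E where
  toLE := modulusLE m
  le_refl f := by
    change m (f - f) = f - f
    rw [sub_self, hm.map_zero]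
  le_trans f g h hfg hgh := by
    change m (h - f) = h - f
    have := hm.map_add_eq hgh hfg
    rwa [sub_add_sub_cancel] at this
  le_antisymm f g hfg hgf := by
    have h1 : m (g - f) = g - f := hfg
    have h2 : m (f - g) = f - g := hgf
    rw [← neg_sub, hm.map_neg, h1] at h2
    have h3 : (2 : ℝ) • (g - f) = 0 := by
      rw [two_smul]
      nth_rewrite 1 [h2]
      abel
    have h4 := (smul_eq_zero.mp h3).resolve_left two_ne_zero
    exact (sub_eq_zero.mp h4).symm

/-- The lattice defined by a real modulus, with `f ⊔ g = (f + g + m (f - g)) / 2`. -/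
@[reducible]
def lattice (hm : IsModulus ℝ m) : Lattice E where
  toPartialOrder := hm.partialOrder
  sup f g := (1 / 2 : ℝ) • (f + g + m (f - g))
  inf f g := (1 / 2 : ℝ) • (f + g - m (f - g))
  le_sup_left f g := by
    change m _ = _
    have := hm.map_smul_real (r := 1 / 2) (by norm_num) (hm.map_sub_self (f - g))
    convert this using 2 <;> module
  le_sup_right f g := by
    change m _ = _
    have := hm.map_smul_real (r := 1 / 2) (by norm_num) (hm.map_add_self (f - g))
    convert this using 2 <;> module
  sup_le f g h hf hg := by
    change m _ = _
    have hf' : m (h - f) = h - f := hf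
    have hg' : m (h - g) = h - g := hg
    have h1 := hm.map_smul_real (r := 2) (by norm_num) hf'
    have h2 := hm.map_smul_real (r := 2) (by norm_num) hg'
    have := hm.map_le (f := f - g) (h := (2 : ℝ) • h - f - g)
      (by convert h1 using 2 <;> module) (by convert h2 using 2 <;> module)
    have h3 := hm.map_smul_real (r := 1 / 2) (by norm_num) this
    convert h3 using 2 <;> module
  inf_le_left f g := by
    change m _ = _
    have := hm.map_smul_real (r := 1 / 2) (by norm_num) (hm.map_add_self (f - g))
    convert this using 2 <;> module
  inf_le_right f g := by
    change m _ = _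
    have := hm.map_smul_real (r := 1 / 2) (by norm_num) (hm.map_sub_self (f - g))
    convert this using 2 <;> module
  le_inf h f g hf hg := by
    change m _ = _
    have hf' : m (f - h) = f - h := hf
    have hg' : m (g - h) = g - h := hg
    have h1 := hm.map_smul_real (r := 2) (by norm_num) hf'
    have h2 := hm.map_smul_real (r := 2) (by norm_num) hg'
    have := hm.map_le (f := f - g) (h := f + g - (2 : ℝ) • h)
      (by convert h2 using 2 <;> module) (by convert h1 using 2 <;> module)
    have h3 := hm.map_smul_real (r := 1 / 2) (by norm_num) this
    convert h3 using 2 <;> module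

end IsModulus

/-- An Archimedean modulus over `ℝ` is the absolute value of an Archimedean vector lattice. -/
theorem IsArchimedeanModulus.exists_lattice (hm : IsArchimedeanModulus ℝ m) :
    ∃ _ : Lattice E, ArchVL E ∧ m = abs := by
  have hM := hm.toIsModulus
  let _ := hM.lattice
  have hle : ∀ f g : E, f ≤ g ↔ m (g - f) = g - f := fun f g => Iff.rfl
  have habs : ∀ f, m f = |f| := fun f => by
    change m f = (1 / 2 : ℝ) • (f + -f + m (f - -f))
    have e : f - -f = (2 : ℝ) • f := by rw [two_smul]; abel
    rw [e, hM.smul_real, abs_of_pos two_pos]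
    module
  refine ⟨inferInstance, ?_, funext habs⟩
  refine { add_le_add_left := ?_, smul_le_smul_of_nonneg_left := ?_, arch := ?_ }
  · intro a b hab c
    rw [hle] at hab ⊢
    simpa using hab
  · intro r hr a b hab
    rw [hle] at hab ⊢
    rw [← smul_sub]
    exact hM.map_smul_real hr hab
  · intro f g h
    have h0 : m g = g := by simpa [hle] using h 0
    refine hm.arch f g fun n _ => ?_
    have := h n
    rwa [hle, ← habs, ← h0] at this

end RealModulus

section VL

variable {E : Type*} [AddCommGroup E] [Lattice E] [Module ℝ E] [ArchVL E]

theorem abs_eq_self_iff_nonneg {f : E} : |f| = f ↔ 0 ≤ f :=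
  ⟨fun h => h ▸ abs_nonneg f, abs_of_nonneg⟩

theorem abs_smul_vl (r : ℝ) (f : E) : |r • f| = |r| • |f| := by
  have key : ∀ r : ℝ, ∀ f : E, |r • f| ≤ |r| • |f| := fun r f => by
    refine abs_le'.mpr ⟨?_, ?_⟩
    · rcases le_total 0 r with hr | hr
      · rw [abs_of_nonneg hr]
        exact smul_le_smul_of_nonneg_left (le_abs_self f) hr
      · rw [abs_of_nonpos hr, ← neg_smul_neg]
        exact smul_le_smul_of_nonneg_left (neg_le_abs f) (by linarith)
    · rcases le_total 0 r with hr | hr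
      · rw [abs_of_nonneg hr, ← smul_neg]
        exact smul_le_smul_of_nonneg_left (neg_le_abs f) hr
      · rw [abs_of_nonpos hr, ← neg_smul]
        exact smul_le_smul_of_nonneg_left (le_abs_self f) (by linarith)
  refine le_antisymm (key r f) ?_
  rcases eq_or_ne r 0 with rfl | hr
  · simp
  have h := smul_le_smul_of_nonneg_left (key r⁻¹ (r • f)) (abs_nonneg r)
  rwa [smul_smul, smul_smul, inv_mul_cancel₀ hr, one_smul, ← abs_mul, mul_inv_cancel₀ hr,
    abs_one, one_smul] at h

theorem smul_le_smul_of_coeff_le {r s : ℝ} (h : r ≤ s) {f : E} (hf : 0 ≤ f) : r • f ≤ s • f := by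
  have := smul_nonneg (sub_nonneg.mpr h) hf
  rwa [sub_smul, sub_nonneg] at this

/-- The absolute value of an Archimedean vector lattice is an Archimedean modulus. -/
theorem isArchimedeanModulus_abs : IsArchimedeanModulus ℝ (abs : E → E) where
  idem f := abs_abs f
  smul a f := by simpa using abs_smul_vl a f
  add f g := by
    rw [abs_of_nonneg (add_nonneg (abs_nonneg f) (abs_nonneg g)), abs_of_nonneg]
    exact sub_nonneg.mpr (abs_add_le f g)
  span := by
    refine Submodule.eq_top_iff'.mpr fun f => ?_
    rw [← posPart_sub_negPart f]
    exact Submodule.sub_mem _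
      (Submodule.subset_span ⟨f⁺, abs_of_nonneg (posPart_nonneg f)⟩)
      (Submodule.subset_span ⟨f⁻, abs_of_nonneg (negPart_nonneg f)⟩)
  arch f g h := by
    have h' : ∀ n : ℕ, 0 < n → n • |f| ≤ |g| := fun n hn => by
      have := h n hn
      rwa [abs_eq_self_iff_nonneg, sub_nonneg] at this
    refine ArchVL.arch f |g| fun n => ?_
    rcases Nat.eq_zero_or_pos n with rfl | hn
    · simp
    · exact h' n hn

theorem modulusLE_abs : modulusLE (abs : E → E) = (inferInstance : LE E) := by
  refine LE.ext ?_
  funext f g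
  refine propext ?_
  change |g - f| = g - f ↔ f ≤ g
  rw [abs_eq_self_iff_nonneg, sub_nonneg]

/-- The form in which the Archimedean property is used. There is no sign condition on `u`. -/
theorem le_of_forall_le_add_one_div_smul {x y u : E}
    (h : ∀ n : ℕ, x ≤ y + (1 / ((n : ℝ) + 1)) • u) : x ≤ y := by
  -- The Archimedean property concerns absolute values, so it is applied to `(x - y)⁺`.
  have hd : (x - y)⁺ = 0 := by
    refine ArchVL.arch _ u⁺ fun n => ?_
    have hn : (0 : ℝ) < (n : ℝ) + 1 := by positivity
    have h1 : (x - y)⁺ ≤ (1 / ((n : ℝ) + 1)) • u⁺ := by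
      refine sup_le ?_ (smul_nonneg (by positivity) (posPart_nonneg u))
      exact (sub_le_iff_le_add'.mpr (h n)).trans
        (smul_le_smul_of_nonneg_left (le_posPart u) (by positivity))
    have h2 := smul_le_smul_of_nonneg_left h1 hn.le
    rw [smul_smul, mul_one_div_cancel hn.ne', one_smul] at h2
    rw [abs_of_nonneg (posPart_nonneg _)]
    refine le_trans ?_ h2
    rw [← Nat.cast_smul_eq_nsmul ℝ]
    exact smul_le_smul_of_coeff_le (by linarith) (posPart_nonneg _)
  have := le_posPart (x - y)
  rw [hd] at this
  exact sub_nonpos.mp this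

end VL

/-! ### Square means in Archimedean vector lattices -/

section BoxApprox

variable {E : Type*} [AddCommGroup E] [Lattice E] [Module ℝ E]

/-- The supremum of `f cos θ + g sin θ` over the angles `θ = 2πk / (n + 1)`, `k ≤ n + 1`. -/
def boxApprox (n : ℕ) (f g : E) : E :=
  (Finset.range (n + 2)).sup' Finset.nonempty_range_add_one fun k =>
    Real.cos (2 * Real.pi * k / (n + 1)) • f + Real.sin (2 * Real.pi * k / (n + 1)) • g

theorem boxApprox_le {n : ℕ} {f g t : E}
    (h : ∀ θ : ℝ, Real.cos θ • f + Real.sin θ • g ≤ t) : boxApprox n f g ≤ t :=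
  Finset.sup'_le _ _ fun _ _ => h _

end BoxApprox

section Box

variable {E : Type*} [AddCommGroup E] [Lattice E] [Module ℝ E] [ArchVL E]

theorem smul_le_abs_smul_abs (r : ℝ) (f : E) : r • f ≤ |r| • |f| :=
  (le_abs_self _).trans_eq (abs_smul_vl r f)

theorem exists_mem_Ico_cos_sin_eq (θ : ℝ) :
    ∃ η ∈ Set.Ico 0 (2 * Real.pi), Real.cos η = Real.cos θ ∧ Real.sin η = Real.sin θ := by
  refine ⟨_, toIcoMod_mem_Ico' Real.two_pi_pos θ, ?_⟩
  rw [toIcoMod, zsmul_eq_mul, Real.cos_sub_int_mul_two_pi, Real.sin_sub_int_mul_two_pi]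
  exact ⟨rfl, rfl⟩

/-- The interval `[0, 2π]` may be replaced by the whole line in the definition of the square
mean. -/
theorem isBoxPlus_abs_iff {f g s : E} : IsBoxPlus abs f g s ↔
    (∀ θ : ℝ, Real.cos θ • f + Real.sin θ • g ≤ s) ∧
      ∀ t, (∀ θ : ℝ, Real.cos θ • f + Real.sin θ • g ≤ t) → s ≤ t := by
  have key : ∀ t : E, (∀ θ ∈ Set.Icc 0 (2 * Real.pi), Real.cos θ • f + Real.sin θ • g ≤ t) →
      ∀ θ : ℝ, Real.cos θ • f + Real.sin θ • g ≤ t := fun t h θ => by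
    obtain ⟨η, hη, hc, hs⟩ := exists_mem_Ico_cos_sin_eq θ
    exact hc ▸ hs ▸ h η ⟨hη.1, hη.2.le⟩
  rw [IsBoxPlus, modulusLE_abs]
  constructor
  · rintro ⟨h1, h2⟩
    refine ⟨key s fun θ hθ => h1 ⟨θ, hθ, rfl⟩, fun t ht => h2 ?_⟩
    rintro _ ⟨θ, _, rfl⟩
    exact ht θ
  · rintro ⟨h1, h2⟩
    refine ⟨?_, fun t ht => h2 t (key t fun θ hθ => ht ⟨θ, hθ, rfl⟩)⟩
    rintro _ ⟨θ, _, rfl⟩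
    exact h1 θ

theorem IsBoxPlus.unique {f g s t : E} (hs : IsBoxPlus abs f g s) (ht : IsBoxPlus abs f g t) :
    s = t := by
  rw [isBoxPlus_abs_iff] at hs ht
  exact le_antisymm (hs.2 t ht.1) (ht.2 s hs.1)

/-- Every bound for the rotations bounds all real combinations, up to the length of the
coefficient vector. -/
theorem smul_add_smul_le_norm_smul {f g t : E} (h : ∀ θ : ℝ, Real.cos θ • f + Real.sin θ • g ≤ t)
    (z : ℂ) : z.re • f + z.im • g ≤ ‖z‖ • t := by
  have := smul_le_smul_of_nonneg_left (h z.arg) (norm_nonneg z)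
  rwa [smul_add, smul_smul, smul_smul, Complex.norm_mul_cos_arg, Complex.norm_mul_sin_arg]
    at this

/-- Neighbouring angles of the grid differ by `2π / (n + 1) ≤ 7 / (n + 1)`, which is where the
constant comes from. -/
theorem le_boxApprox (n : ℕ) (f g : E) (θ : ℝ) : Real.cos θ • f + Real.sin θ • g ≤
    boxApprox n f g + (1 / ((n : ℝ) + 1)) • ((7 : ℝ) • (|f| + |g|)) := by
  revert θ
  have key : ∀ θ ∈ Set.Ico 0 (2 * Real.pi), Real.cos θ • f + Real.sin θ • g ≤
      boxApprox n f g + (1 / ((n : ℝ) + 1)) • ((7 : ℝ) • (|f| + |g|)) := fun θ hθ => by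
    have hp := Real.two_pi_pos
    have hn : (0 : ℝ) < (n : ℝ) + 1 := by positivity
    set x : ℝ := θ * (n + 1) / (2 * Real.pi) with hx
    have hx0 : 0 ≤ x := div_nonneg (mul_nonneg hθ.1 hn.le) hp.le
    set k := ⌊x⌋₊ with hk
    set η : ℝ := 2 * Real.pi * k / (n + 1) with hη
    have hkx : (k : ℝ) ≤ x := Nat.floor_le hx0
    have hxk : x < k + 1 := Nat.lt_floor_add_one x
    have hkn : k ∈ Finset.range (n + 2) := by
      have : x < (n + 2 : ℕ) := by
        rw [hx, div_lt_iff₀ hp]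
        push_cast
        nlinarith [hθ.2]
      exact Finset.mem_range.mpr ((Nat.floor_lt hx0).mpr this)
    have hθx : θ = 2 * Real.pi * x / (n + 1) := by
      rw [hx]
      field_simp
    have hd : |θ - η| ≤ 1 / ((n : ℝ) + 1) * 7 := by
      have e : θ - η = 2 * Real.pi * (x - k) / (n + 1) := by
        rw [hθx, hη]
        ring
      rw [e, abs_of_nonneg (by have := sub_nonneg.mpr hkx; positivity), div_le_iff₀ hn]
      have e2 : 1 / ((n : ℝ) + 1) * 7 * (n + 1) = 7 := by field_simp
      rw [e2]
      nlinarith [Real.pi_lt_d2, Real.pi_pos]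
    have hc : |Real.cos θ - Real.cos η| ≤ 1 / ((n : ℝ) + 1) * 7 :=
      (Real.abs_cos_sub_cos_le θ η).trans hd
    have hs : |Real.sin θ - Real.sin η| ≤ 1 / ((n : ℝ) + 1) * 7 :=
      (Real.abs_sin_sub_sin_le θ η).trans hd
    have h1 : Real.cos η • f + Real.sin η • g ≤ boxApprox n f g :=
      Finset.le_sup' (fun k : ℕ => Real.cos (2 * Real.pi * k / (n + 1)) • f +
        Real.sin (2 * Real.pi * k / (n + 1)) • g) hkn
    have h2 := (smul_le_abs_smul_abs (Real.cos θ - Real.cos η) f).trans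
      (smul_le_smul_of_coeff_le hc (abs_nonneg f))
    have h3 := (smul_le_abs_smul_abs (Real.sin θ - Real.sin η) g).trans
      (smul_le_smul_of_coeff_le hs (abs_nonneg g))
    calc Real.cos θ • f + Real.sin θ • g
        = (Real.cos η • f + Real.sin η • g) + ((Real.cos θ - Real.cos η) • f +
          (Real.sin θ - Real.sin η) • g) := by module
      _ ≤ boxApprox n f g + ((1 / ((n : ℝ) + 1) * 7) • |f| + (1 / ((n : ℝ) + 1) * 7) • |g|) :=
          add_le_add h1 (add_le_add h2 h3)
      _ = _ := by module
  intro θ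
  obtain ⟨η, hη, hc, hs⟩ := exists_mem_Ico_cos_sin_eq θ
  exact hc ▸ hs ▸ key η hη

/-- The square mean is the relatively uniform limit of its finite approximations. The right-hand
side only involves lattice operations, so homomorphisms preserve it. -/
theorem isBoxPlus_iff_boxApprox {f g s : E} : IsBoxPlus abs f g s ↔
    ∀ n, boxApprox n f g ≤ s ∧
      s ≤ boxApprox n f g + (1 / ((n : ℝ) + 1)) • ((7 : ℝ) • (|f| + |g|)) := by
  rw [isBoxPlus_abs_iff]
  constructor
  · exact fun h n => ⟨boxApprox_le h.1, h.2 _ (le_boxApprox n f g)⟩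
  · refine fun h => ⟨fun θ => ?_, fun t ht => ?_⟩
    · exact le_of_forall_le_add_one_div_smul fun n =>
        (le_boxApprox n f g θ).trans (add_le_add_left (h n).1 _)
    · exact le_of_forall_le_add_one_div_smul fun n =>
        (h n).2.trans (add_le_add_left (boxApprox_le ht) _)

theorem two_smul_sup (f g : E) : (2 : ℝ) • (f ⊔ g) = f + g + |g - f| := by
  rw [← two_nsmul_sup_eq_add_add_abs_sub, two_smul, two_nsmul]

variable {F : Type*} [AddCommGroup F] [Lattice F] [Module ℝ F] [ArchVL F]

namespace IsVLHom

variable {T : E →ₗ[ℝ] F}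

theorem map_sup (hT : IsVLHom ℝ abs abs T) (f g : E) : T (f ⊔ g) = T f ⊔ T g := by
  have h : (2 : ℝ) • T (f ⊔ g) = (2 : ℝ) • (T f ⊔ T g) := by
    rw [two_smul_sup, ← map_smul, two_smul_sup, map_add, map_add, hT, map_sub]
  exact smul_right_injective F two_ne_zero h

theorem mono (hT : IsVLHom ℝ abs abs T) {f g : E} (h : f ≤ g) : T f ≤ T g := by
  rw [← sup_eq_right] at h ⊢
  rw [← hT.map_sup, h]

theorem map_boxApprox (hT : IsVLHom ℝ abs abs T) (n : ℕ) (f g : E) :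
    T (boxApprox n f g) = boxApprox n (T f) (T g) := by
  rw [boxApprox, Finset.apply_sup'_eq_sup'_comp _ T (hT.map_sup)]
  simp only [Function.comp_def, map_add, map_smul]
  rfl

/-- Vector lattice homomorphisms preserve existing square means. -/
theorem isBoxPlus (hT : IsVLHom ℝ abs abs T) {f g s : E} (h : IsBoxPlus abs f g s) :
    IsBoxPlus abs (T f) (T g) (T s) := by
  rw [isBoxPlus_iff_boxApprox] at h ⊢
  intro n
  have h1 := hT.mono (h n).1
  have h2 := hT.mono (h n).2
  rw [map_add, map_smul, map_smul, map_add, hT, hT] at h2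
  rw [hT.map_boxApprox] at h1 h2
  exact ⟨h1, h2⟩

end IsVLHom

end Box

/-! ### Homogeneous subadditive extensions of the absolute value are square means -/

section Grid

variable {L : Type*} [AddCommGroup L] [Lattice L] [Module ℝ L] [ArchVL L]

/-- If `0 ≤ f ≤ (k + 1) • v` and `w` lies below all the distances `|f - j • v|`, then `w ≤ v`.
Pointwise this holds because every number in `[0, k + 1]` is at distance at most `1` from an
integer. -/
theorem le_of_le_abs_sub_natCast_smul {f v w : L} (hf : 0 ≤ f) (hv : 0 ≤ v) (k : ℕ)
    (hfk : f ≤ ((k : ℝ) + 1) • v) (hw : ∀ j : ℕ, w ≤ |f - (j : ℝ) • v|) : w ≤ v := by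
  let _ := AddCommGroup.toDistribLattice L
  set p := (w - v)⁺ with hp
  have hp0 : 0 ≤ p := posPart_nonneg _
  -- Where `w > v`, either `f > (j + 1) v` or `f < (j - 1) v`.
  have split : ∀ j : ℕ, p ≤ (f - ((j : ℝ) + 1) • v)⁺ ⊔ (((j : ℝ) - 1) • v - f)⁺ := fun j => by
    refine sup_le ?_ (le_sup_of_le_left (posPart_nonneg _))
    rw [sub_le_iff_le_add]
    refine (hw j).trans (abs_le'.mpr ⟨?_, ?_⟩)
    · rw [← sub_le_iff_le_add]
      refine le_sup_of_le_left (le_trans (le_of_eq ?_) (le_posPart _))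
      module
    · rw [← sub_le_iff_le_add]
      refine le_sup_of_le_right (le_trans (le_of_eq ?_) (le_posPart _))
      module
  -- The second alternative is excluded step by step: it is disjoint from `f > j v`.
  have main : ∀ j : ℕ, p ≤ (f - ((j : ℝ) + 1) • v)⁺ := fun j => by
    induction j with
    | zero =>
      have h := split 0
      have e : (((0 : ℕ) : ℝ) - 1) • v - f ≤ 0 := by
        have : (((0 : ℕ) : ℝ) - 1) • v - f = -(v + f) := by
          push_cast
          module
        rw [this]
        exact neg_nonpos.mpr (add_nonneg hv hf)
      rwa [posPart_eq_zero.mpr e, sup_eq_left.mpr (posPart_nonneg _)] at h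
    | succ j ih =>
      have h := le_inf ih (split (j + 1))
      rw [inf_sup_left] at h
      refine h.trans (sup_le inf_le_right ?_)
      refine le_trans ?_ (posPart_nonneg _)
      have e : (f - (((j + 1 : ℕ) : ℝ) - 1) • v)⁻ = ((((j + 1 : ℕ) : ℝ) - 1) • v - f)⁺ := by
        rw [← posPart_neg, neg_sub]
      rw [← posPart_inf_negPart_eq_zero (f - (((j + 1 : ℕ) : ℝ) - 1) • v), e]
      refine inf_le_inf_right _ (posPart_mono (sub_le_sub_left (smul_le_smul_of_coeff_le ?_ hv) f))
      push_cast
      linarith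
  have h := main k
  rw [posPart_eq_zero.mpr (sub_nonpos.mpr hfk)] at h
  exact sub_nonpos.mp ((le_posPart _).trans h)

/-- In an Archimedean vector lattice an element `f` of the ideal of `u` is at distance zero from
the real multiples of `u`, in the sense that no nonzero positive element lies below all
`|f - a • u|`. -/
theorem nonpos_of_le_abs_sub_smul {f u w : L} (hu : |f| ≤ u)
    (hw : ∀ a : ℝ, w ≤ |f - a • u|) : w ≤ 0 := by
  have hu0 : 0 ≤ u := (abs_nonneg f).trans hu
  -- `f` is shifted to `f + u`, which lies between `0` and `2 u = (2 n + 2) (u / (n + 1))`.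
  have h1 : 0 ≤ f + u := neg_le_iff_add_nonneg.mp (neg_le.mp ((neg_le_abs f).trans hu))
  have h2 : f + u ≤ (2 : ℝ) • u := by
    rw [two_smul]
    exact add_le_add_left ((le_abs_self f).trans hu) u
  refine le_of_forall_le_add_one_div_smul (u := u) fun n => ?_
  have hn : (0 : ℝ) < (n : ℝ) + 1 := by positivity
  rw [zero_add]
  refine le_of_le_abs_sub_natCast_smul (f := f + u) h1 (smul_nonneg (by positivity) hu0) (2 * n + 1)
    ?_ fun j => ?_
  · rw [smul_smul]
    convert h2 using 2
    push_cast
    field_simp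
    ring
  · convert hw ((j : ℝ) * (1 / ((n : ℝ) + 1)) - 1) using 2
    module

/-- The two-dimensional version: the minimization over `a` and over `b` can be done separately. -/
theorem nonpos_of_le_abs_sub_smul_add {f g u w : L} (hf : |f| ≤ u) (hg : |g| ≤ u)
    (hw : ∀ a b : ℝ, w ≤ (2 : ℝ) • (|f - a • u| + |g - b • u|)) : w ≤ 0 := by
  have h2 : (0 : ℝ) ≤ 1 / 2 := by norm_num
  have h : (1 / 2 : ℝ) • w ≤ 0 :=
    nonpos_of_le_abs_sub_smul hg fun b => sub_nonpos.mp <|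
      nonpos_of_le_abs_sub_smul hf fun a => sub_le_iff_le_add.mpr <| by
        simpa only [smul_smul, one_div_mul_cancel (two_ne_zero' ℝ), one_smul] using
          smul_le_smul_of_nonneg_left (hw a b) h2
  simpa only [smul_smul, mul_one_div_cancel (two_ne_zero' ℝ), one_smul, smul_zero] using
    smul_le_smul_of_nonneg_left h (zero_le_two (α := ℝ))

/-- A map `N` with values in an Archimedean vector lattice `L` that is defined on a complex vector
space containing `L`, satisfies the triangle inequality, is absolutely homogeneous, and extends the
absolute value of `L`, is given by square means. -/
theorem isBoxPlus_of_triangle {F : Type*} [AddCommGroup F] [Module ℂ F] (J : L →ₗ[ℝ] F)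
    (N : F → L) (hadd : ∀ x y, N (x + y) ≤ N x + N y)
    (hsmul : ∀ (c : ℂ) x, N (c • x) = ‖c‖ • N x) (habs : ∀ f, N (J f) = |f|) (f g : L) :
    IsBoxPlus abs f g (N (J f + Complex.I • J g)) := by
  -- `N` is Lipschitz in both coordinates.
  have hdist : ∀ f g f' g' : L, N (J f + Complex.I • J g) ≤
      N (J f' + Complex.I • J g') + (|f - f'| + |g - g'|) := fun f g f' g' => by
    have e : J f + Complex.I • J g = (J f' + Complex.I • J g') +
        (J (f - f') + Complex.I • J (g - g')) := by
      rw [map_sub, map_sub]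
      module
    have h := hadd (J (f - f')) (Complex.I • J (g - g'))
    rw [hsmul, Complex.norm_I, one_smul, habs, habs] at h
    rw [e]
    exact (hadd _ _).trans (add_le_add_right h _)
  have hpt : ∀ (u : L) (a b : ℝ), 0 ≤ u → N (J (a • u) + Complex.I • J (b • u)) =
      ‖(⟨a, b⟩ : ℂ)‖ • u := fun u a b hu => by
    have e : J (a • u) + Complex.I • J (b • u) = (⟨a, b⟩ : ℂ) • J u := by
      rw [map_smul, map_smul, Complex.mk_eq_add_mul_I, add_smul, mul_comm, mul_smul,
        Complex.coe_smul, Complex.coe_smul]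
    rw [e, hsmul, habs, abs_of_nonneg hu]
  -- The real part is dominated: `f ≤ a u + |f - au|`, and `a u ≤ |a + ib| u = N ((a + ib) u)`.
  have hre : ∀ f g : L, f ≤ N (J f + Complex.I • J g) := fun f g => by
    set u := |f| + |g|
    have hu : 0 ≤ u := add_nonneg (abs_nonneg f) (abs_nonneg g)
    refine sub_nonpos.mp <| nonpos_of_le_abs_sub_smul_add (f := f) (g := g) (u := u)
      (le_add_of_nonneg_right (abs_nonneg g)) (le_add_of_nonneg_left (abs_nonneg f))
      fun a b => ?_
    have h1 := hdist (a • u) (b • u) f g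
    rw [hpt u a b hu, abs_sub_comm, abs_sub_comm (b • u)] at h1
    have h2 : a • u ≤ ‖(⟨a, b⟩ : ℂ)‖ • u :=
      smul_le_smul_of_coeff_le ((le_abs_self a).trans (Complex.abs_re_le_norm (⟨a, b⟩ : ℂ))) hu
    have h3 : f ≤ a • u + |f - a • u| := by
      rw [← sub_le_iff_le_add']
      exact le_abs_self _
    rw [sub_le_iff_le_add]
    calc f ≤ (N (J f + Complex.I • J g) + (|f - a • u| + |g - b • u|)) + |f - a • u| :=
            h3.trans (add_le_add_left (h2.trans h1) _)
        _ ≤ (N (J f + Complex.I • J g) + (|f - a • u| + |g - b • u|)) +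
            (|f - a • u| + |g - b • u|) :=
            add_le_add_right (le_add_of_nonneg_right (abs_nonneg _)) _
        _ = _ := by module
  rw [isBoxPlus_abs_iff]
  refine ⟨fun θ => ?_, fun t ht => ?_⟩
  -- `f cos θ + g sin θ` is the real part of `(f + ig)` rotated by `-θ`.
  · have h := hre (Real.cos θ • f + Real.sin θ • g) (Real.cos θ • g - Real.sin θ • f)
    have e : J (Real.cos θ • f + Real.sin θ • g) +
        Complex.I • J (Real.cos θ • g - Real.sin θ • f) =
        (⟨Real.cos θ, -Real.sin θ⟩ : ℂ) • (J f + Complex.I • J g) := by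
      have hc : ∀ (r : ℝ) (x : F), r • x = (r : ℂ) • x := fun r x => (Complex.coe_smul r x).symm
      simp only [map_add, map_sub, map_smul, hc]
      rw [Complex.mk_eq_add_mul_I]
      push_cast
      match_scalars
      · ring_nf
      · ring_nf
        simp
    have hn : ‖(⟨Real.cos θ, -Real.sin θ⟩ : ℂ)‖ = 1 := by
      rw [Complex.norm_def, Complex.normSq_mk, Real.sqrt_eq_one]
      linarith [Real.sin_sq_add_cos_sq θ]
    rwa [e, hsmul, hn, one_smul] at h
  · set u := |f| + |g|
    have hu : 0 ≤ u := add_nonneg (abs_nonneg f) (abs_nonneg g)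
    refine sub_nonpos.mp <| nonpos_of_le_abs_sub_smul_add (f := f) (g := g) (u := u)
      (le_add_of_nonneg_right (abs_nonneg g)) (le_add_of_nonneg_left (abs_nonneg f))
      fun a b => ?_
    have h1 := hdist f g (a • u) (b • u)
    rw [hpt u a b hu] at h1
    -- With `θ = arg (a + ib)`, `|a + ib| u = (a cos θ + b sin θ) u` is close to
    -- `f cos θ + g sin θ`, which is bounded by `t`.
    have h2 : ‖(⟨a, b⟩ : ℂ)‖ • u ≤ (|f - a • u| + |g - b • u|) + t := by
      set c := Real.cos (Complex.arg ⟨a, b⟩) with hc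
      set s := Real.sin (Complex.arg ⟨a, b⟩) with hs
      have e1 : a = ‖(⟨a, b⟩ : ℂ)‖ * c := (Complex.norm_mul_cos_arg ⟨a, b⟩).symm
      have e2 : b = ‖(⟨a, b⟩ : ℂ)‖ * s := (Complex.norm_mul_sin_arg ⟨a, b⟩).symm
      have e3 : ‖(⟨a, b⟩ : ℂ)‖ = c * a + s * b := by
        have : c ^ 2 + s ^ 2 = 1 := by rw [hc, hs]; exact Real.cos_sq_add_sin_sq _
        linear_combination -‖(⟨a, b⟩ : ℂ)‖ * this - c * e1 - s * e2
      have h3 := (smul_le_abs_smul_abs c (a • u - f)).trans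
        (smul_le_smul_of_coeff_le (Real.abs_cos_le_one _) (abs_nonneg _))
      have h4 := (smul_le_abs_smul_abs s (b • u - g)).trans
        (smul_le_smul_of_coeff_le (Real.abs_sin_le_one _) (abs_nonneg _))
      rw [one_smul, abs_sub_comm] at h3 h4
      calc ‖(⟨a, b⟩ : ℂ)‖ • u = (c • (a • u - f) + s • (b • u - g)) + (c • f + s • g) := by
            rw [e3]
            module
        _ ≤ _ := add_le_add (add_le_add h3 h4) (ht _)
    rw [sub_le_iff_le_add]
    refine (h1.trans (add_le_add_left h2 _)).trans_eq ?_
    module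

end Grid

/-! ### The real part of a complex vector lattice -/

section Restrict

variable {V : Type*} [AddCommGroup V] [Module ℝ V] {m : V → V}

/-- The restriction of a map, usually a modulus, to an invariant subspace. -/
def restrictModulus (p : Submodule ℝ V) (hp : ∀ x ∈ p, m x ∈ p) : p → p :=
  fun x => ⟨m x, hp x x.2⟩

/-- The map `m` on the whole space need not satisfy the spanning axiom over `ℝ`: this covers both
the real part of a complex vector lattice and sublattices of real ones. -/
theorem isArchimedeanModulus_restrictModulus (p : Submodule ℝ V) (hp : ∀ x ∈ p, m x ∈ p)
    (idem : ∀ f, m (m f) = m f) (smul : ∀ (a : ℝ) (f : V), m (a • f) = |a| • m f)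
    (add : ∀ f g, m (m (m f + m g) - m (f + g)) = m f + m g - m (f + g))
    (arch : ∀ f g, (∀ n : ℕ, 0 < n → m (m g - n • m f) = m g - n • m f) → f = 0)
    (sub : ∀ x ∈ p, ∃ a ∈ p, ∃ b ∈ p, x = m a - m b) :
    IsArchimedeanModulus ℝ (restrictModulus p hp) where
  idem f := Subtype.ext (idem f)
  smul a f := by
    refine Subtype.ext ?_
    change m (a • (f : V)) = (RCLike.ofReal ‖a‖ : ℝ) • m f
    rw [smul, RCLike.ofReal_real_eq_id, id, Real.norm_eq_abs]
  add f g := Subtype.ext (add f g)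
  span := by
    refine Submodule.eq_top_iff'.mpr fun x => ?_
    obtain ⟨a, ha, b, hb, hx⟩ := sub x x.2
    have e : x = restrictModulus p hp ⟨a, ha⟩ - restrictModulus p hp ⟨b, hb⟩ := Subtype.ext hx
    rw [e]
    exact Submodule.sub_mem _ (Submodule.subset_span ⟨_, rfl⟩) (Submodule.subset_span ⟨_, rfl⟩)
  arch f g h := Subtype.ext (arch f g fun n hn => congrArg Subtype.val (h n hn))

end Restrict

section RealPart

variable {F : Type*} [AddCommGroup F] [Module ℂ F] {m : F → F}

namespace IsModulus

/-- The real part `m(F) - m(F)` of a complex vector lattice, as a real subspace. -/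
def realPart (hm : IsModulus ℂ m) : Submodule ℝ F where
  carrier := modulusRealPart m
  zero_mem' := ⟨0, 0, by simp⟩
  add_mem' := by
    rintro _ _ ⟨a, b, rfl⟩ ⟨c, d, rfl⟩
    refine ⟨m a + m c, m b + m d, ?_⟩
    rw [hm.map_add_eq (hm.idem a) (hm.idem c), hm.map_add_eq (hm.idem b) (hm.idem d)]
    abel
  smul_mem' := by
    rintro r _ ⟨a, b, rfl⟩
    have key : ∀ r : ℝ, 0 ≤ r → ∀ a, m (r • a) = r • m a := fun r hr a => by
      rw [RCLike.real_smul_eq_coe_smul (K := ℂ), hm.smul, RCLike.norm_ofReal, abs_of_nonneg hr,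
        ← RCLike.real_smul_eq_coe_smul (K := ℂ)]
    rcases le_total 0 r with hr | hr
    · exact ⟨r • a, r • b, by rw [key r hr, key r hr, smul_sub]⟩
    · refine ⟨(-r) • b, (-r) • a, ?_⟩
      rw [key _ (neg_nonneg.mpr hr), key _ (neg_nonneg.mpr hr)]
      module

theorem map_mem_realPart (hm : IsModulus ℂ m) (z : F) : m z ∈ hm.realPart :=
  ⟨z, 0, by rw [hm.map_zero, sub_zero]⟩

/-- The restriction of the modulus to the real part. -/
def realPartModulus (hm : IsModulus ℂ m) : hm.realPart → hm.realPart :=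
  restrictModulus hm.realPart fun x _ => hm.map_mem_realPart x

end IsModulus

namespace IsArchimedeanModulus

theorem isArchimedeanModulus_realPart (hm : IsArchimedeanModulus ℂ m) :
    IsArchimedeanModulus ℝ hm.realPartModulus := by
  refine isArchimedeanModulus_restrictModulus _ _ hm.idem (fun a f => ?_) hm.add hm.arch ?_
  · rw [RCLike.real_smul_eq_coe_smul (K := ℂ), hm.smul, RCLike.norm_ofReal,
      ← RCLike.real_smul_eq_coe_smul (K := ℂ)]
  · rintro _ ⟨a, b, rfl⟩
    refine ⟨m a, hm.map_mem_realPart a, m b, hm.map_mem_realPart b, ?_⟩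
    rw [hm.idem, hm.idem]

/-- The modulus of `f + ig`, for `f` and `g` in the real part, is the square mean of `f` and
`g`. -/
theorem isBoxPlus_realPart (hm : IsArchimedeanModulus ℂ m) (f g : hm.realPart) :
    IsBoxPlus hm.realPartModulus f g
      ⟨m ((f : F) + Complex.I • (g : F)), hm.map_mem_realPart _⟩ := by
  obtain ⟨_, _, habs⟩ := hm.isArchimedeanModulus_realPart.exists_lattice
  rw [habs]
  refine isBoxPlus_of_triangle hm.realPart.subtype
    (fun z => ⟨m z, hm.map_mem_realPart z⟩) (fun x y => ?_) (fun c x => ?_) (fun f => ?_) f g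
  · rw [← sub_nonneg, ← abs_eq_self_iff_nonneg, ← habs]
    exact Subtype.ext (hm.triangle x y)
  · refine Subtype.ext ?_
    change m (c • x) = ‖c‖ • m x
    rw [hm.smul, ← RCLike.real_smul_eq_coe_smul (K := ℂ)]
  · rw [← habs]
    rfl

theorem isSquareMeanComplete_realPart (hm : IsArchimedeanModulus ℂ m) :
    IsSquareMeanComplete hm.realPartModulus :=
  fun f g => ⟨_, hm.isBoxPlus_realPart f g⟩

end IsArchimedeanModulus

end RealPart

/-! ### The modulus on the vector space complexification -/

theorem IsSquareMeanComplete.isBoxPlus {M : Type*} [AddCommGroup M] [Module ℝ M] {m : M → M}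
    (h : IsSquareMeanComplete m) (f g : M) : IsBoxPlus m f g (boxPlus m f g) := by
  rw [boxPlus, dif_pos (h f g)]
  exact (h f g).choose_spec

namespace VSComplexification

variable {M : Type u} [AddCommGroup M] [Module ℝ M]

theorem ofReal_re (x : M) : (ofReal x).re = x := rfl

theorem ofReal_im (x : M) : (ofReal x).im = 0 := rfl

theorem ofReal_injective : Function.Injective (ofReal : M →ₗ[ℝ] VSComplexification M) :=
  fun _ _ h => congrArg re h

theorem eq_ofReal_add (z : VSComplexification M) :
    z = ofReal z.re + Complex.I • ofReal z.im := by
  ext <;> simp [ofReal_re, ofReal_im]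

theorem ofReal_smul (r : ℝ) (x : M) : ofReal (r • x) = (RCLike.ofReal r : ℂ) • ofReal x := by
  rw [map_smul, RCLike.real_smul_eq_coe_smul (K := ℂ)]

theorem modulus_apply {m : M → M} (z : VSComplexification M) :
    modulus m z = ofReal (boxPlus m z.re z.im) := rfl

variable [Lattice M] [ArchVL M]

theorem isBoxPlus_zero_right (t : M) : IsBoxPlus abs t 0 |t| := by
  rw [isBoxPlus_abs_iff]
  refine ⟨fun θ => ?_, fun s hs => abs_le'.mpr ⟨by simpa using hs 0, by simpa using hs Real.pi⟩⟩
  rw [smul_zero, add_zero]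
  refine (smul_le_abs_smul_abs _ t).trans ?_
  simpa using smul_le_smul_of_coeff_le (Real.abs_cos_le_one θ) (abs_nonneg t)

theorem modulus_ofReal (hC : IsSquareMeanComplete (abs : M → M))
    (t : M) : modulus abs (ofReal t) = ofReal |t| :=
  congrArg ofReal ((hC.isBoxPlus t 0).unique (isBoxPlus_zero_right t))

theorem boxPlus_smul_le (hC : IsSquareMeanComplete (abs : M → M))
    (c : ℂ) (z : VSComplexification M) :
    boxPlus abs (c • z).re (c • z).im ≤ ‖c‖ • boxPlus abs z.re z.im := by
  refine (isBoxPlus_abs_iff.mp (hC.isBoxPlus _ _)).2 _ fun θ => ?_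
  -- The coefficients are those of `e^{iθ}` times the conjugate of `c`.
  have h := smul_add_smul_le_norm_smul (isBoxPlus_abs_iff.mp (hC.isBoxPlus z.re z.im)).1
    (⟨Real.cos θ * c.re + Real.sin θ * c.im, Real.sin θ * c.re - Real.cos θ * c.im⟩ : ℂ)
  have hn : ‖(⟨Real.cos θ * c.re + Real.sin θ * c.im,
      Real.sin θ * c.re - Real.cos θ * c.im⟩ : ℂ)‖ = ‖c‖ := by
    rw [Complex.norm_def, Complex.norm_def, Complex.normSq_apply, Complex.normSq_apply]
    congr 1
    linear_combination (c.re ^ 2 + c.im ^ 2) * Real.sin_sq_add_cos_sq θ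
  rw [hn] at h
  refine le_trans (le_of_eq ?_) h
  simp only [smul_re, smul_im]
  module

theorem boxPlus_smul (hC : IsSquareMeanComplete (abs : M → M)) (c : ℂ) (z : VSComplexification M) :
    boxPlus abs (c • z).re (c • z).im = ‖c‖ • boxPlus abs z.re z.im := by
  refine le_antisymm (boxPlus_smul_le hC c z) ?_
  rcases eq_or_ne c 0 with rfl | hc
  · rw [zero_smul, norm_zero, zero_smul, zero_re, zero_im,
      (hC.isBoxPlus 0 0).unique (isBoxPlus_zero_right 0), abs_zero]
  -- The reverse inequality is the same estimate for `c⁻¹`.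
  have h := boxPlus_smul_le hC c⁻¹ (c • z)
  rw [inv_smul_smul₀ hc, norm_inv] at h
  have h2 := smul_le_smul_of_nonneg_left h (norm_nonneg c)
  rwa [smul_smul, mul_inv_cancel₀ (norm_ne_zero_iff.mpr hc), one_smul] at h2

theorem abs_re_le_boxPlus (hC : IsSquareMeanComplete (abs : M → M))
    (f g : M) : |f| ≤ boxPlus abs f g := by
  have h := (isBoxPlus_abs_iff.mp (hC.isBoxPlus f g)).1
  exact abs_le'.mpr ⟨by simpa using h 0, by simpa using h Real.pi⟩

theorem boxPlus_nonneg (hC : IsSquareMeanComplete (abs : M → M))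
    (f g : M) : 0 ≤ boxPlus abs f g :=
  (abs_nonneg f).trans (abs_re_le_boxPlus hC f g)

theorem modulus_eq_self_of_nonneg (hC : IsSquareMeanComplete (abs : M → M))
    {t : M} (ht : 0 ≤ t) :
    modulus abs (ofReal t) = ofReal t := by
  rw [modulus_ofReal hC, abs_of_nonneg ht]

theorem boxPlus_add_le (hC : IsSquareMeanComplete (abs : M → M))
    (z w : VSComplexification M) : boxPlus abs (z + w).re (z + w).im ≤
    boxPlus abs z.re z.im + boxPlus abs w.re w.im := by
  refine (isBoxPlus_abs_iff.mp (hC.isBoxPlus _ _)).2 _ fun θ => ?_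
  have h1 := (isBoxPlus_abs_iff.mp (hC.isBoxPlus z.re z.im)).1 θ
  have h2 := (isBoxPlus_abs_iff.mp (hC.isBoxPlus w.re w.im)).1 θ
  refine le_trans (le_of_eq ?_) (add_le_add h1 h2)
  simp only [add_re, add_im]
  module

theorem isArchimedeanModulus_modulus (hC : IsSquareMeanComplete (abs : M → M))
    :
    IsArchimedeanModulus ℂ (modulus (abs : M → M)) where
  idem z := modulus_eq_self_of_nonneg hC (boxPlus_nonneg hC _ _)
  smul c z := by
    rw [modulus, boxPlus_smul hC, ofReal_smul]
    rfl
  add z w := by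
    have h1 := modulus_eq_self_of_nonneg hC
      (add_nonneg (boxPlus_nonneg hC z.re z.im) (boxPlus_nonneg hC w.re w.im))
    have h2 := modulus_eq_self_of_nonneg hC (sub_nonneg.mpr (boxPlus_add_le hC z w))
    rw [map_add] at h1
    rw [map_sub, map_add] at h2
    rw [modulus_apply z, modulus_apply w, modulus_apply (z + w), h1]
    exact h2
  span := by
    have key : ∀ x : M, ofReal x ∈ Submodule.span ℂ (Set.range (modulus (abs : M → M))) :=
      fun x => by
        rw [← posPart_sub_negPart x, map_sub]
        exact Submodule.sub_mem _
          (Submodule.subset_span ⟨_, modulus_eq_self_of_nonneg hC (posPart_nonneg x)⟩)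
          (Submodule.subset_span ⟨_, modulus_eq_self_of_nonneg hC (negPart_nonneg x)⟩)
    refine Submodule.eq_top_iff'.mpr fun z => ?_
    rw [eq_ofReal_add z]
    exact Submodule.add_mem _ (key _) (Submodule.smul_mem _ _ (key _))
  arch z w h := by
    have h0 : boxPlus abs z.re z.im = 0 := by
      refine isArchimedeanModulus_abs.arch _ (boxPlus abs w.re w.im) fun n hn => ?_
      have h1 := h n hn
      rw [abs_of_nonneg (boxPlus_nonneg hC z.re z.im),
        abs_of_nonneg (boxPlus_nonneg hC w.re w.im)]
      rw [modulus_apply z, modulus_apply w, ← map_nsmul, ← map_sub, modulus_ofReal hC] at h1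
      exact ofReal_injective h1
    have hre : z.re = 0 := by
      have h1 := abs_re_le_boxPlus hC z.re z.im
      rw [h0] at h1
      exact le_antisymm ((le_abs_self _).trans h1) (neg_nonpos.mp ((neg_le_abs _).trans h1))
    have him : z.im = 0 := by
      have h1 := (isBoxPlus_abs_iff.mp (hC.isBoxPlus z.re z.im)).1
      rw [h0, hre] at h1
      refine le_antisymm (by simpa using h1 (Real.pi / 2)) ?_
      have := h1 (-(Real.pi / 2))
      rw [Real.sin_neg, Real.sin_pi_div_two, neg_one_smul, smul_zero, zero_add] at this
      exact neg_nonpos.mp this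
    ext
    · exact hre
    · exact him

end VSComplexification

/-! ### The complexification of a square mean completion -/

namespace VSComplexification

variable {M : Type*} [AddCommGroup M] [Module ℝ M] {F : Type*} [AddCommGroup F] [Module ℂ F]

/-- The complex-linear extension `f + ig ↦ S f + i S g` of a real-linear map `S`. -/
def lift (S : M →ₗ[ℝ] F) : VSComplexification M →ₗ[ℂ] F where
  toFun z := S z.re + Complex.I • S z.im
  map_add' z w := by
    rw [add_re, add_im, map_add, map_add]
    module
  map_smul' c z := by
    simp only [smul_re, smul_im, map_add, map_sub, map_smul, RingHom.id_apply,
      ← Complex.coe_smul]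
    nth_rewrite 5 [← Complex.re_add_im c]
    match_scalars
    · ring
    · ring_nf
      simp

theorem lift_apply (S : M →ₗ[ℝ] F) (z : VSComplexification M) :
    lift S z = S z.re + Complex.I • S z.im := rfl

theorem lift_ofReal (S : M →ₗ[ℝ] F) (x : M) : lift S (ofReal x) = S x := by
  rw [lift_apply, ofReal_re, ofReal_im, map_zero, smul_zero, add_zero]

theorem eq_lift (S : VSComplexification M →ₗ[ℂ] F) :
    S = lift (S.restrictScalars ℝ ∘ₗ ofReal) := by
  refine LinearMap.ext fun z => ?_
  conv_lhs => rw [eq_ofReal_add z, map_add, map_smul]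
  rfl

end VSComplexification

open VSComplexification

theorem IsArchimedeanModulus.exists_eq_sub {M : Type*} [AddCommGroup M] [Module ℝ M] {m : M → M}
    (hm : IsArchimedeanModulus ℝ m) (x : M) : ∃ a b, x = m a - m b := by
  obtain ⟨p, q, hp, hq, rfl⟩ := hm.exists_sub x
  exact ⟨p, q, by rw [hp, hq]⟩

/-- Vector lattice homomorphisms preserve the chosen square means. -/
theorem IsVLHom.map_boxPlus {M N : Type*} [AddCommGroup M] [Module ℝ M] [AddCommGroup N]
    [Module ℝ N] {mM : M → M} {mN : N → N} (hM : IsArchimedeanModulus ℝ mM)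
    (hN : IsArchimedeanModulus ℝ mN) (hC : IsSquareMeanComplete mM) {S : M →ₗ[ℝ] N}
    (hS : IsVLHom ℝ mM mN S) (f g : M) : IsBoxPlus mN (S f) (S g) (S (boxPlus mM f g)) := by
  obtain ⟨_, _, rfl⟩ := hM.exists_lattice
  obtain ⟨_, _, rfl⟩ := hN.exists_lattice
  exact hS.isBoxPlus (hC.isBoxPlus f g)

theorem IsBoxPlus.unique' {M : Type*} [AddCommGroup M] [Module ℝ M] {m : M → M}
    (hM : IsArchimedeanModulus ℝ m) {f g s t : M} (hs : IsBoxPlus m f g s)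
    (ht : IsBoxPlus m f g t) : s = t := by
  obtain ⟨_, _, rfl⟩ := hM.exists_lattice
  exact hs.unique ht

namespace IsSquareMeanComplete

variable {M : Type*} [AddCommGroup M] [Module ℝ M] {mM : M → M}

theorem modulus_ofReal (hC : IsSquareMeanComplete mM) (hM : IsArchimedeanModulus ℝ mM) (x : M) :
    modulus mM (ofReal x) = ofReal (mM x) := by
  obtain ⟨_, _, rfl⟩ := hM.exists_lattice
  exact VSComplexification.modulus_ofReal hC x

theorem ofReal_mem_realPart (hC : IsSquareMeanComplete mM) (hM : IsArchimedeanModulus ℝ mM)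
    (x : M) : ofReal x ∈ modulusRealPart (modulus mM) := by
  obtain ⟨a, b, rfl⟩ := hM.exists_eq_sub x
  exact ⟨ofReal a, ofReal b, by
    rw [hC.modulus_ofReal hM, hC.modulus_ofReal hM, map_sub]⟩

theorem isArchimedeanModulus_modulus (hC : IsSquareMeanComplete mM)
    (hM : IsArchimedeanModulus ℝ mM) : IsArchimedeanModulus ℂ (modulus mM) := by
  obtain ⟨_, _, rfl⟩ := hM.exists_lattice
  exact VSComplexification.isArchimedeanModulus_modulus hC

variable {F : Type*} [AddCommGroup F] [Module ℂ F] {mF : F → F}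

/-- The complex-linear extension of a homomorphism into the real part is a homomorphism. -/
theorem isVLHom_lift (hC : IsSquareMeanComplete mM) (hM : IsArchimedeanModulus ℝ mM)
    (hF : IsArchimedeanModulus ℂ mF) {S : M →ₗ[ℝ] hF.realPart}
    (hS : IsVLHom ℝ mM hF.realPartModulus S) :
    IsVLHom ℂ (modulus mM) mF (lift (hF.realPart.subtype ∘ₗ S)) := fun z => by
  have h := IsBoxPlus.unique' hF.isArchimedeanModulus_realPart
    (hS.map_boxPlus hM hF.isArchimedeanModulus_realPart hC z.re z.im)
    (hF.isBoxPlus_realPart (S z.re) (S z.im))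
  rw [modulus_apply, lift_ofReal]
  exact congrArg Subtype.val h

/-- A homomorphism on `M ⊕ iM` maps `M` into the real part. -/
theorem map_ofReal_mem_realPart (hC : IsSquareMeanComplete mM) (hM : IsArchimedeanModulus ℝ mM)
    {S : VSComplexification M →ₗ[ℂ] F} (hS : IsVLHom ℂ (modulus mM) mF S) (x : M) :
    S (ofReal x) ∈ modulusRealPart mF := by
  obtain ⟨a, b, h⟩ := hC.ofReal_mem_realPart hM x
  exact ⟨S a, S b, by rw [h, map_sub, hS, hS]⟩

end IsSquareMeanComplete

/-- If `M` is a square mean completion of `E` then `M ⊕ iM` is a vector lattice complexification.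
The universal property of `M` is applied to the real parts of the complex targets, which are square
mean complete. -/
theorem IsSquareMeanCompletion.isVLComplexification {E : Type u} [AddCommGroup E] [Module ℝ E]
    {mE : E → E} {M : Type v} [AddCommGroup M] [Module ℝ M]
    {mM : M → M} {φ : E →ₗ[ℝ] M} (h : IsSquareMeanCompletion.{u, v, w} mE mM φ) :
    IsVLComplexification.{u, v, w} mE (VSComplexification.modulus mM) (ofReal ∘ₗ φ) where
  modulus := h.complete.isArchimedeanModulus_modulus h.modulus
  hom :=
    { mem_realPart := fun f => h.complete.ofReal_mem_realPart h.modulus (φ f)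
      hom := fun f => by
        rw [LinearMap.comp_apply, LinearMap.comp_apply, h.hom,
          h.complete.modulus_ofReal h.modulus] }
  injective := ofReal_injective.comp h.injective
  universal F _ _ mF hF T hT := by
    have hFρ := hF.isArchimedeanModulus_realPart
    obtain ⟨S, ⟨hS, hST⟩, huniq⟩ := h.universal hF.realPart hF.realPartModulus hFρ
      hF.isSquareMeanComplete_realPart (T.codRestrict hF.realPart hT.mem_realPart)
      (fun f => Subtype.ext (hT.hom f))
    refine ⟨lift (hF.realPart.subtype ∘ₗ S), ⟨h.complete.isVLHom_lift h.modulus hF hS,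
      fun f => ?_⟩, ?_⟩
    · rw [LinearMap.comp_apply, lift_ofReal]
      exact congrArg Subtype.val (hST f)
    · rintro S' ⟨hS', hST'⟩
      have e := huniq ((S'.restrictScalars ℝ ∘ₗ ofReal).codRestrict hF.realPart
        (h.complete.map_ofReal_mem_realPart h.modulus hS')) ⟨fun x => Subtype.ext ?_,
          fun f => Subtype.ext (hST' f)⟩
      · rw [eq_lift S', ← e]
        rfl
      · change S' (ofReal (mM x)) = mF (S' (ofReal x))
        rw [← hS', h.complete.modulus_ofReal h.modulus]

/-! ### Uniqueness of the complexification -/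

namespace IsVLComplexification

variable {E : Type u} [AddCommGroup E] [Module ℝ E] {mE : E → E}
  {C₁ C₂ : Type w} [AddCommGroup C₁] [Module ℂ C₁] [AddCommGroup C₂] [Module ℂ C₂]
  {m₁ : C₁ → C₁} {m₂ : C₂ → C₂} {φ₁ : E →ₗ[ℝ] C₁} {φ₂ : E →ₗ[ℝ] C₂}

theorem comp_eq_id (h₁ : IsVLComplexification.{u, w, w} mE m₁ φ₁) {S : C₁ →ₗ[ℂ] C₂}
    {S' : C₂ →ₗ[ℂ] C₁} (hS : IsVLHom ℂ m₁ m₂ S) (hS' : IsVLHom ℂ m₂ m₁ S')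
    (hSφ : ∀ f, S (φ₁ f) = φ₂ f) (hSφ' : ∀ f, S' (φ₂ f) = φ₁ f) :
    S' ∘ₗ S = LinearMap.id :=
  (h₁.universal C₁ m₁ h₁.modulus φ₁ h₁.hom).unique
    ⟨fun f => by rw [LinearMap.comp_apply, hS, hS', LinearMap.comp_apply],
      fun f => by rw [LinearMap.comp_apply, hSφ, hSφ']⟩ ⟨fun _ => rfl, fun _ => rfl⟩

theorem existsUnique_equiv (h₁ : IsVLComplexification.{u, w, w} mE m₁ φ₁)
    (h₂ : IsVLComplexification.{u, w, w} mE m₂ φ₂) :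
    ∃! γ : C₁ ≃ₗ[ℂ] C₂, IsVLHom ℂ m₁ m₂ γ.toLinearMap ∧ ∀ f, γ (φ₁ f) = φ₂ f := by
  obtain ⟨S, ⟨hS, hSφ⟩, huniq⟩ := h₁.universal C₂ m₂ h₂.modulus φ₂ h₂.hom
  obtain ⟨S', ⟨hS', hSφ'⟩, -⟩ := h₂.universal C₁ m₁ h₁.modulus φ₁ h₁.hom
  refine ⟨LinearEquiv.ofLinearMap S S' (h₂.comp_eq_id hS' hS hSφ' hSφ)
    (h₁.comp_eq_id hS hS' hSφ hSφ'), ⟨hS, hSφ⟩, fun γ hγ => ?_⟩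
  exact LinearEquiv.toLinearMap_injective (huniq γ.toLinearMap hγ)

end IsVLComplexification

/-! ### Relatively uniform completion by Cauchy sequences -/

section Sequences

variable {E : Type u} [AddCommGroup E] [Lattice E] [Module ℝ E] [ArchVL E]

theorem one_div_succ_nonneg (n : ℕ) : (0 : ℝ) ≤ 1 / ((n : ℝ) + 1) := by positivity

theorem one_div_succ_anti {n k : ℕ} (h : n ≤ k) :
    1 / ((k : ℝ) + 1) ≤ 1 / ((n : ℝ) + 1) :=
  Nat.one_div_le_one_div h

theorem nonneg_of_abs_le_smul {n : ℕ} {f u : E} (h : |f| ≤ (1 / ((n : ℝ) + 1)) • u) :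
    0 ≤ u := by
  have h2 := smul_le_smul_of_nonneg_left ((abs_nonneg f).trans h)
    (by positivity : (0 : ℝ) ≤ (n : ℝ) + 1)
  rwa [smul_zero, smul_smul, mul_one_div_cancel (by positivity), one_smul] at h2

theorem abs_sub_le_iff_vl {f g u : E} : |f - g| ≤ u ↔ f ≤ g + u ∧ g ≤ f + u := by
  rw [abs_le', neg_sub, sub_le_iff_le_add', sub_le_iff_le_add']

theorem eq_zero_of_abs_le {f u : E} (h : ∀ n : ℕ, |f| ≤ (1 / ((n : ℝ) + 1)) • u) : f = 0 := by
  have h0 : |f| ≤ 0 := le_of_forall_le_add_one_div_smul fun n => by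
    rw [zero_add]
    exact h n
  exact le_antisymm ((le_abs_self f).trans h0) (neg_nonpos.mp ((neg_le_abs f).trans h0))

/-- The sequence `x` is relatively uniformly Cauchy with regulator `u`. The rate `1 / (n + 1)` is
fixed, which costs no limits: subsequences attain any rate. -/
def IsRUCauchy (x : ℕ → E) (u : E) : Prop :=
  ∀ n k : ℕ, n ≤ k → |x n - x k| ≤ (1 / ((n : ℝ) + 1)) • u

namespace IsRUCauchy

variable {x y : ℕ → E} {u v : E}

theorem nonneg (hx : IsRUCauchy x u) : 0 ≤ u :=
  nonneg_of_abs_le_smul (hx 0 0 le_rfl)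

theorem mono (hx : IsRUCauchy x u) (h : u ≤ v) : IsRUCauchy x v := fun n k hnk =>
  (hx n k hnk).trans (smul_le_smul_of_nonneg_left h (one_div_succ_nonneg n))

theorem add (hx : IsRUCauchy x u) (hy : IsRUCauchy y v) : IsRUCauchy (x + y) (u + v) :=
  fun n k hnk => by
    rw [smul_add, Pi.add_apply, Pi.add_apply, add_sub_add_comm]
    exact (abs_add_le _ _).trans (add_le_add (hx n k hnk) (hy n k hnk))

theorem smul (hx : IsRUCauchy x u) (r : ℝ) : IsRUCauchy (r • x) (|r| • u) := fun n k hnk => by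
  rw [Pi.smul_apply, Pi.smul_apply, ← smul_sub, abs_smul_vl, smul_comm]
  exact smul_le_smul_of_nonneg_left (hx n k hnk) (abs_nonneg r)

theorem sub (hx : IsRUCauchy x u) (hy : IsRUCauchy y v) : IsRUCauchy (x - y) (u + v) := by
  have h := hx.add (hy.smul (-1))
  rwa [abs_neg, abs_one, one_smul, neg_one_smul, ← sub_eq_add_neg] at h

theorem abs (hx : IsRUCauchy x u) : IsRUCauchy (fun n => |x n|) u := fun n k hnk =>
  (abs_abs_sub_abs_le _ _).trans (hx n k hnk)

theorem bounded (hx : IsRUCauchy x u) (n : ℕ) : |x n| ≤ |x 0| + u := by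
  have h := hx 0 n (Nat.zero_le n)
  rw [Nat.cast_zero, zero_add, div_one, one_smul, abs_sub_comm] at h
  calc |x n| = |x 0 + (x n - x 0)| := by rw [add_sub_cancel]
    _ ≤ |x 0| + |x n - x 0| := abs_add_le _ _
    _ ≤ _ := add_le_add_right h _

/-- If the negative parts of a Cauchy sequence tend to zero with some regulator `v`, then they do so
with the regulator `u` of the sequence itself. This gives uniform control of infinitely many
inequalities that hold in the limit. -/
theorem neg_smul_le (hx : IsRUCauchy x u)
    (hv : ∀ n : ℕ, -((1 / ((n : ℝ) + 1)) • v) ≤ x n) (n : ℕ) :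
    -((1 / ((n : ℝ) + 1)) • u) ≤ x n := by
  have h : ∀ k : ℕ, -((1 / ((n : ℝ) + 1)) • u) ≤ x n + (1 / ((k : ℝ) + 1)) • |v| := fun k => by
    have h1 : -((1 / ((k : ℝ) + 1)) • |v|) ≤ -((1 / (((max n k : ℕ) : ℝ) + 1)) • v) :=
      neg_le_neg ((smul_le_smul_of_nonneg_left (le_abs_self v) (one_div_succ_nonneg _)).trans
        (smul_le_smul_of_coeff_le (one_div_succ_anti (le_max_right n k)) (abs_nonneg v)))
    have h2 := (abs_sub_le_iff_vl.mp (hx n (max n k) (le_max_left n k))).2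
    have h3 := (h1.trans (hv _)).trans h2
    rw [neg_le_iff_add_nonneg] at h3 ⊢
    refine h3.trans_eq ?_
    abel
  exact le_of_forall_le_add_one_div_smul h

end IsRUCauchy

theorem boxApprox_le_add (n : ℕ) (f g f' g' : E) :
    boxApprox n f g ≤ boxApprox n f' g' + (|f - f'| + |g - g'|) := by
  refine Finset.sup'_le _ _ fun k hk => ?_
  set θ : ℝ := 2 * Real.pi * k / (n + 1) with hθ
  have h1 : Real.cos θ • f' + Real.sin θ • g' ≤ boxApprox n f' g' :=
    Finset.le_sup' (fun k : ℕ => Real.cos (2 * Real.pi * k / (n + 1)) • f' +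
      Real.sin (2 * Real.pi * k / (n + 1)) • g') hk
  have h2 := (smul_le_abs_smul_abs (Real.cos θ) (f - f')).trans
    (smul_le_smul_of_coeff_le (Real.abs_cos_le_one θ) (abs_nonneg _))
  have h3 := (smul_le_abs_smul_abs (Real.sin θ) (g - g')).trans
    (smul_le_smul_of_coeff_le (Real.abs_sin_le_one θ) (abs_nonneg _))
  rw [one_smul] at h2 h3
  calc Real.cos θ • f + Real.sin θ • g = (Real.cos θ • f' + Real.sin θ • g') +
        (Real.cos θ • (f - f') + Real.sin θ • (g - g')) := by module
    _ ≤ _ := add_le_add h1 (add_le_add h2 h3)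

theorem boxApprox_le_boxApprox (n k : ℕ) (f g : E) :
    boxApprox n f g ≤ boxApprox k f g + (1 / ((k : ℝ) + 1)) • ((7 : ℝ) • (|f| + |g|)) :=
  boxApprox_le (le_boxApprox k f g)

theorem IsRUCauchy.boxApprox {x y : ℕ → E} {u v : E} (hx : IsRUCauchy x u)
    (hy : IsRUCauchy y v) : IsRUCauchy (fun n => boxApprox n (x n) (y n))
      ((7 : ℝ) • ((|x 0| + u) + (|y 0| + v)) + (u + v)) := fun n k hnk => by
  have hb : (7 : ℝ) • (|x k| + |y k|) ≤ (7 : ℝ) • ((|x 0| + u) + (|y 0| + v)) :=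
    smul_le_smul_of_nonneg_left (add_le_add (hx.bounded k) (hy.bounded k)) (by norm_num)
  have hb0 : 0 ≤ (7 : ℝ) • (|x k| + |y k|) :=
    smul_nonneg (by norm_num) (add_nonneg (abs_nonneg _) (abs_nonneg _))
  have hn := smul_le_smul_of_nonneg_left hb (one_div_succ_nonneg n)
  have hd := add_le_add (hx n k hnk) (hy n k hnk)
  rw [← smul_add] at hd
  refine abs_sub_le_iff_vl.mpr ⟨?_, ?_⟩
  · calc _ ≤ _ := boxApprox_le_add n _ _ (x k) (y k)
      _ ≤ _ := add_le_add (boxApprox_le_boxApprox n k _ _) hd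
      _ ≤ _ := add_le_add_left (add_le_add_right
          ((smul_le_smul_of_coeff_le (one_div_succ_anti hnk) hb0).trans hn) _) _
      _ = _ := by module
  · have h := boxApprox_le_add n (x k) (y k) (x n) (y n)
    rw [abs_sub_comm, abs_sub_comm (y k)] at h
    calc _ ≤ _ := boxApprox_le_boxApprox k n (x k) (y k)
      _ ≤ _ := add_le_add (h.trans (add_le_add_right hd _)) hn
      _ = _ := by module

variable (E) in
/-- The relatively uniformly Cauchy sequences. -/
def ruCauchy : Submodule ℝ (ℕ → E) where
  carrier := {x | ∃ u, IsRUCauchy x u}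
  zero_mem' := ⟨0, fun n k _ => by simp⟩
  add_mem' := fun ⟨u, hu⟩ ⟨v, hv⟩ => ⟨u + v, hu.add hv⟩
  smul_mem' := fun r _ ⟨u, hu⟩ => ⟨|r| • u, hu.smul r⟩

variable (E) in
/-- The sequences that converge to zero relatively uniformly at the rate `1 / (n + 1)`. -/
def ruNull : Submodule ℝ (ruCauchy E) where
  carrier := {x | ∃ u, ∀ n : ℕ, |x.1 n| ≤ (1 / ((n : ℝ) + 1)) • u}
  zero_mem' := ⟨0, fun n => by simp⟩
  add_mem' := fun ⟨u, hu⟩ ⟨v, hv⟩ => ⟨u + v, fun n => by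
    rw [smul_add]
    exact (abs_add_le _ _).trans (add_le_add (hu n) (hv n))⟩
  smul_mem' := fun r x ⟨u, hu⟩ => ⟨|r| • u, fun n => by
    change |r • x.1 n| ≤ _
    rw [abs_smul_vl, smul_comm]
    exact smul_le_smul_of_nonneg_left (hu n) (abs_nonneg r)⟩

theorem mem_ruNull {x : ruCauchy E} :
    x ∈ ruNull E ↔ ∃ u, ∀ n : ℕ, |x.1 n| ≤ (1 / ((n : ℝ) + 1)) • u := Iff.rfl

variable (E) in
/-- The space of relatively uniform limits of sequences in `E`: Cauchy sequences modulo null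
sequences. It contains the square means of its elements, but it need not be relatively uniformly
complete, because only regulators in `E` occur. -/
abbrev RUCompletion : Type u := ruCauchy E ⧸ ruNull E

namespace RUCompletion

variable (E) in
/-- The class of a Cauchy sequence. -/
def mk : ruCauchy E →ₗ[ℝ] RUCompletion E := (ruNull E).mkQ

theorem mk_surjective : Function.Surjective (mk E) :=
  (ruNull E).mkQ_surjective

theorem mk_eq_mk {x y : ruCauchy E} : mk E x = mk E y ↔
    ∃ u, ∀ n : ℕ, |x.1 n - y.1 n| ≤ (1 / ((n : ℝ) + 1)) • u :=
  (Submodule.Quotient.eq (ruNull E)).trans mem_ruNull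

/-- The pointwise absolute value of a Cauchy sequence. -/
def seqAbs (x : ruCauchy E) : ruCauchy E :=
  ⟨fun n => |x.1 n|, x.2.imp fun _ h => h.abs⟩

/-- The modulus on the completion, induced by the pointwise absolute value. -/
def modulus : RUCompletion E → RUCompletion E :=
  Quotient.lift (fun x => mk E (seqAbs x)) fun x y h => by
    obtain ⟨u, hu⟩ := mk_eq_mk.mp (Quotient.sound h : mk E x = mk E y)
    exact mk_eq_mk.mpr ⟨u, fun n => (abs_abs_sub_abs_le _ _).trans (hu n)⟩

theorem modulus_mk (x : ruCauchy E) : modulus (mk E x) = mk E (seqAbs x) := rfl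

/-- A class is positive if and only if the negative parts of its representatives are null
sequences. -/
theorem modulus_mk_eq_self {x : ruCauchy E} :
    modulus (mk E x) = mk E x ↔ ∃ u, ∀ n : ℕ, -((1 / ((n : ℝ) + 1)) • u) ≤ x.1 n := by
  rw [modulus_mk, mk_eq_mk]
  constructor
  · rintro ⟨u, hu⟩
    refine ⟨u, fun n => ?_⟩
    have h1 := (abs_sub_le_iff_vl.mp (hu n)).1
    have hu0 := nonneg_of_abs_le_smul (hu n)
    have h2 : -(x.1 n) ≤ x.1 n + (1 / ((n : ℝ) + 1)) • u := (neg_le_abs _).trans h1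
    have h3 : 0 ≤ (1 / 2 : ℝ) • (x.1 n + (x.1 n + (1 / ((n : ℝ) + 1)) • u)) :=
      smul_nonneg (by norm_num) (neg_le_iff_add_nonneg'.mp h2)
    have h4 : 0 ≤ (1 / 2 : ℝ) • (1 / ((n : ℝ) + 1)) • u :=
      smul_nonneg (by norm_num) (smul_nonneg (one_div_succ_nonneg n) hu0)
    rw [neg_le_iff_add_nonneg]
    refine (add_nonneg h3 h4).trans_eq ?_
    module
  · rintro ⟨u, hu⟩
    refine ⟨u + |u|, fun n => ?_⟩
    change |(|x.1 n| - x.1 n)| ≤ _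
    rw [abs_of_nonneg (sub_nonneg.mpr (le_abs_self _)), sub_le_iff_le_add]
    have h1 := neg_le_iff_add_nonneg.mp (hu n)
    calc |x.1 n| = |(x.1 n + (1 / ((n : ℝ) + 1)) • u) + (-(1 / ((n : ℝ) + 1))) • u| := by
          congr 1
          module
      _ ≤ _ := abs_add_le _ _
      _ = (x.1 n + (1 / ((n : ℝ) + 1)) • u) + (1 / ((n : ℝ) + 1)) • |u| := by
          rw [abs_of_nonneg h1, abs_smul_vl, abs_neg, abs_of_nonneg (one_div_succ_nonneg n)]
      _ = _ := by module

theorem isArchimedeanModulus : IsArchimedeanModulus ℝ (modulus (E := E)) where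
  idem f := by
    obtain ⟨x, rfl⟩ := mk_surjective f
    exact congrArg (mk E) (Subtype.ext (funext fun n => abs_abs _))
  smul a f := by
    obtain ⟨x, rfl⟩ := mk_surjective f
    rw [RCLike.ofReal_real_eq_id, id, Real.norm_eq_abs, ← map_smul, modulus_mk, modulus_mk,
      ← map_smul]
    exact congrArg (mk E) (Subtype.ext (funext fun n => abs_smul_vl _ _))
  add f g := by
    obtain ⟨x, rfl⟩ := mk_surjective f
    obtain ⟨y, rfl⟩ := mk_surjective g
    exact congrArg (mk E) (Subtype.ext (funext fun n => isArchimedeanModulus_abs.add _ _))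
  span := by
    refine Submodule.eq_top_iff'.mpr fun f => ?_
    obtain ⟨x, rfl⟩ := mk_surjective f
    have key : ∀ y : ruCauchy E, (∀ n, 0 ≤ y.1 n) →
        mk E y ∈ Submodule.span ℝ (Set.range (modulus (E := E))) := fun y hy =>
      Submodule.subset_span ⟨mk E y,
        congrArg (mk E) (Subtype.ext (funext fun n => abs_of_nonneg (hy n)))⟩
    have e : mk E x = (1 / 2 : ℝ) • (mk E (seqAbs x + x) - mk E (seqAbs x - x)) := by
      rw [map_add, map_sub]
      module
    rw [e]
    exact Submodule.smul_mem _ _ (Submodule.sub_mem _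
      (key _ fun n => neg_le_iff_add_nonneg.mp (neg_le_abs _))
      (key _ fun n => sub_nonneg.mpr (le_abs_self _)))
  arch f g h := by
    obtain ⟨x, rfl⟩ := mk_surjective f
    obtain ⟨y, rfl⟩ := mk_surjective g
    obtain ⟨u, hu⟩ := x.2
    obtain ⟨v, hv⟩ := y.2
    -- The inequalities `(N + 1) |x| ≤ |y|` hold in the limit, each with its own regulator;
    -- `IsRUCauchy.neg_smul_le` replaces that by one depending linearly on `N`.
    have h' : ∀ N k : ℕ, -((1 / ((k : ℝ) + 1)) • (v + |(N : ℝ) + 1| • u)) ≤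
        |y.1 k| - ((N : ℝ) + 1) • |x.1 k| := fun N => by
      have h1 := h (N + 1) N.succ_pos
      have e : modulus (mk E y) - (N + 1) • modulus (mk E x) =
          mk E (seqAbs y - ((N : ℝ) + 1) • seqAbs x) := by
        rw [modulus_mk, modulus_mk, map_sub, map_smul, ← Nat.cast_smul_eq_nsmul ℝ]
        push_cast
        rfl
      rw [e] at h1
      obtain ⟨w, hw⟩ := modulus_mk_eq_self.mp h1
      exact (hv.abs.sub (hu.abs.smul ((N : ℝ) + 1))).neg_smul_le hw
    have h0 : mk E x = mk E 0 := mk_eq_mk.mpr ⟨u, fun k => by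
      change |x.1 k - 0| ≤ _
      rw [sub_zero]
      refine le_of_forall_le_add_one_div_smul (u := |y.1 k| + (1 / ((k : ℝ) + 1)) • v) fun N => ?_
      have hN : (0 : ℝ) < (N : ℝ) + 1 := by positivity
      have h1 := h' N k
      rw [neg_le_iff_add_nonneg, abs_of_pos hN] at h1
      have h2 := smul_nonneg (one_div_succ_nonneg N) h1
      rw [← sub_nonneg]
      refine h2.trans_eq ?_
      match_scalars <;> field_simp⟩
    rw [h0, map_zero]

variable (E) in
/-- The embedding by constant sequences. -/
def of : E →ₗ[ℝ] RUCompletion E :=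
  mk E ∘ₗ LinearMap.codRestrict (ruCauchy E) (LinearMap.pi fun _ => LinearMap.id)
    fun e => ⟨0, fun n k _ => by simp⟩

theorem of_injective : Function.Injective (of E) := by
  refine (injective_iff_map_eq_zero _).mpr fun e he => ?_
  obtain ⟨u, hu⟩ := mem_ruNull.mp ((Submodule.Quotient.mk_eq_zero (ruNull E)).mp he)
  exact eq_zero_of_abs_le hu

/-- The sequence of finite approximations of the square mean of two Cauchy sequences. -/
def seqBox (x y : ruCauchy E) : ruCauchy E :=
  ⟨fun n => boxApprox n (x.1 n) (y.1 n), by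
    obtain ⟨u, hu⟩ := x.2
    obtain ⟨v, hv⟩ := y.2
    exact ⟨_, hu.boxApprox hv⟩⟩

/-- The class of the finite approximations is the square mean. -/
theorem isBoxPlus_mk (x y : ruCauchy E) :
    IsBoxPlus modulus (mk E x) (mk E y) (mk E (seqBox x y)) := by
  obtain ⟨u, hu⟩ := x.2
  obtain ⟨v, hv⟩ := y.2
  obtain ⟨_, _, habs⟩ := (isArchimedeanModulus (E := E)).exists_lattice
  have hle : ∀ a b : ruCauchy E, mk E a ≤ mk E b ↔
      ∃ u, ∀ n : ℕ, -((1 / ((n : ℝ) + 1)) • u) ≤ b.1 n - a.1 n := fun a b => by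
    rw [← sub_nonneg, ← abs_eq_self_iff_nonneg, ← habs, ← map_sub, modulus_mk_eq_self]
    rfl
  have hrot : ∀ θ : ℝ, Real.cos θ • mk E x + Real.sin θ • mk E y =
      mk E (Real.cos θ • x + Real.sin θ • y) := fun θ => by
    rw [map_add, map_smul, map_smul]
  rw [habs, isBoxPlus_abs_iff]
  refine ⟨fun θ => ?_, fun t ht => ?_⟩
  · rw [hrot, hle]
    refine ⟨(7 : ℝ) • ((|x.1 0| + u) + (|y.1 0| + v)), fun n => ?_⟩
    have h := le_boxApprox n (x.1 n) (y.1 n) θ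
    have hb := smul_le_smul_of_nonneg_left (smul_le_smul_of_nonneg_left
      (add_le_add (hu.bounded n) (hv.bounded n)) (by norm_num : (0 : ℝ) ≤ 7))
      (one_div_succ_nonneg n)
    rw [neg_le_sub_iff_le_add]
    exact h.trans (add_le_add_right hb _)
  -- An upper bound `t` dominates each rotation up to a null sequence. Its regulator can be chosen
  -- independently of `θ`, so the estimate survives the supremum over the grid.
  · obtain ⟨t, rfl⟩ := mk_surjective t
    obtain ⟨w, hw⟩ := t.2
    rw [hle]
    refine ⟨w + (u + v), fun n => ?_⟩
    rw [neg_le_sub_iff_le_add]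
    refine boxApprox_le fun θ => ?_
    have h := ht θ
    rw [hrot, hle] at h
    obtain ⟨z, hz⟩ := h
    have hc := (hu.smul (Real.cos θ)).mono
      ((smul_le_smul_of_coeff_le (Real.abs_cos_le_one θ) hu.nonneg).trans_eq (one_smul ℝ u))
    have hs := (hv.smul (Real.sin θ)).mono
      ((smul_le_smul_of_coeff_le (Real.abs_sin_le_one θ) hv.nonneg).trans_eq (one_smul ℝ v))
    have h1 := (hw.sub (hc.add hs)).neg_smul_le hz n
    exact neg_le_sub_iff_le_add.mp h1

end RUCompletion

end Sequences

/-! ### The square mean completion -/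

/-- Restricting the modulus to an invariant subspace preserves square means that lie in it. -/
theorem IsBoxPlus.restrict {V : Type*} [AddCommGroup V] [Module ℝ V] {m : V → V}
    {p : Submodule ℝ V} {hp : ∀ x ∈ p, m x ∈ p} {f g s : p}
    (h : IsBoxPlus m (f : V) (g : V) (s : V)) : IsBoxPlus (restrictModulus p hp) f g s := by
  let _ := modulusLE m
  refine ⟨?_, fun t ht => Subtype.ext ((show _ ∈ lowerBounds _ from h.2) (a := (t : V)) ?_)⟩
  · rintro _ ⟨θ, hθ, rfl⟩
    exact Subtype.ext (h.1 ⟨θ, hθ, rfl⟩)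
  · rintro _ ⟨θ, hθ, rfl⟩
    exact congrArg Subtype.val (ht ⟨θ, hθ, rfl⟩)

section SquareMeanHull

variable {E : Type u} [AddCommGroup E] [Lattice E] [Module ℝ E] [ArchVL E]

open RUCompletion

theorem isSquareMeanComplete_ruCompletion :
    IsSquareMeanComplete (RUCompletion.modulus (E := E)) := fun f g => by
  obtain ⟨x, rfl⟩ := mk_surjective f
  obtain ⟨y, rfl⟩ := mk_surjective g
  exact ⟨_, isBoxPlus_mk x y⟩

/-- Membership in the smallest vector sublattice of the relatively uniform completion that
contains `E` and is closed under square means. -/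
inductive MemSquareMeanHull : RUCompletion E → Prop
  | of (e : E) : MemSquareMeanHull (of E e)
  | add {x y : RUCompletion E} : MemSquareMeanHull x → MemSquareMeanHull y →
      MemSquareMeanHull (x + y)
  | smul (r : ℝ) {x : RUCompletion E} : MemSquareMeanHull x → MemSquareMeanHull (r • x)
  | modulus {x : RUCompletion E} : MemSquareMeanHull x → MemSquareMeanHull (modulus x)
  | box {x y s : RUCompletion E} : MemSquareMeanHull x → MemSquareMeanHull y →
      IsBoxPlus RUCompletion.modulus x y s → MemSquareMeanHull s

variable (E) in
/-- The vector sublattice of the relatively uniform completion generated by `E` under square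
means. -/
def squareMeanHull : Submodule ℝ (RUCompletion E) where
  carrier := {x | MemSquareMeanHull x}
  zero_mem' := by
    have h := MemSquareMeanHull.of (0 : E)
    rwa [map_zero] at h
  add_mem' := MemSquareMeanHull.add
  smul_mem' r _ := MemSquareMeanHull.smul r

variable (E) in
/-- The modulus on the square mean hull, restricted from the relatively uniform completion. -/
def squareMeanHullModulus : squareMeanHull E → squareMeanHull E :=
  restrictModulus (m := RUCompletion.modulus) (squareMeanHull E)
    fun _ => MemSquareMeanHull.modulus

theorem isArchimedeanModulus_squareMeanHull :
    IsArchimedeanModulus ℝ (squareMeanHullModulus E) := by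
  have hm := RUCompletion.isArchimedeanModulus (E := E)
  have h2 : (0 : ℝ) ≤ 1 / 2 := by norm_num
  refine isArchimedeanModulus_restrictModulus _ _ hm.idem hm.smul_real hm.add hm.arch
    fun x hx => ⟨(1 / 2 : ℝ) • (RUCompletion.modulus x + x), ?_,
      (1 / 2 : ℝ) • (RUCompletion.modulus x - x), ?_, ?_⟩
  · exact Submodule.smul_mem _ _ (Submodule.add_mem _ (MemSquareMeanHull.modulus hx) hx)
  · exact Submodule.smul_mem _ _ (Submodule.sub_mem _ (MemSquareMeanHull.modulus hx) hx)
  · rw [hm.map_smul_real h2 (hm.map_add_self x), hm.map_smul_real h2 (hm.map_sub_self x)]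
    module

theorem isSquareMeanComplete_squareMeanHull :
    IsSquareMeanComplete (squareMeanHullModulus E) := fun f g => by
  obtain ⟨s, hs⟩ := isSquareMeanComplete_ruCompletion (f : RUCompletion E) g
  exact ⟨⟨s, MemSquareMeanHull.box f.2 g.2 hs⟩, hs.restrict⟩

variable (E) in
/-- The embedding of `E` into its square mean hull. -/
def toSquareMeanHull : E →ₗ[ℝ] squareMeanHull E :=
  (of E).codRestrict (squareMeanHull E) MemSquareMeanHull.of

/-- A homomorphism on the square mean hull is determined by its values on `E`, because
homomorphisms preserve square means. -/
theorem squareMeanHull_hom_ext {F : Type*} [AddCommGroup F] [Module ℝ F] {mF : F → F}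
    (hF : IsArchimedeanModulus ℝ mF) {S S' : squareMeanHull E →ₗ[ℝ] F}
    (hS : IsVLHom ℝ (squareMeanHullModulus E) mF S)
    (hS' : IsVLHom ℝ (squareMeanHullModulus E) mF S')
    (h : ∀ e, S (toSquareMeanHull E e) = S' (toSquareMeanHull E e)) : S = S' := by
  have key : ∀ (x : RUCompletion E) (hx : MemSquareMeanHull x), S ⟨x, hx⟩ = S' ⟨x, hx⟩ :=
    fun x hx => by
    induction hx with
    | of e => exact h e
    | add hx hy ihx ihy =>
      have e := congrArg₂ (· + ·) ihx ihy
      simp only [← map_add] at e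
      exact e
    | smul r hx ih =>
      have e := congrArg (r • ·) ih
      simp only [← map_smul] at e
      exact e
    | modulus hx ih =>
      have e := congrArg mF ih
      rw [← hS, ← hS'] at e
      exact e
    | @box x y s hx hy hs ihx ihy =>
      have hr : IsBoxPlus (squareMeanHullModulus E) ⟨x, hx⟩ ⟨y, hy⟩
          ⟨s, MemSquareMeanHull.box hx hy hs⟩ := IsBoxPlus.restrict hs
      obtain ⟨_, _, hH⟩ := (isArchimedeanModulus_squareMeanHull (E := E)).exists_lattice
      obtain ⟨_, _, rfl⟩ := hF.exists_lattice
      rw [hH] at hr hS hS'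
      have h1 := hS.isBoxPlus hr
      have h2 := hS'.isBoxPlus hr
      rw [ihx, ihy] at h1
      exact h1.unique h2
  exact LinearMap.ext fun x => key x x.2

section Extension

variable {F : Type v} [AddCommGroup F] [Lattice F] [Module ℝ F] [ArchVL F]

/-- `y` is the relatively uniform limit of the images under `T` of a sequence in `E` that
converges to `x`. -/
def IsRULimit (T : E →ₗ[ℝ] F) (x : RUCompletion E) (y : F) : Prop :=
  ∃ a : ruCauchy E, mk E a = x ∧ ∃ u, ∀ n : ℕ, |T (a.1 n) - y| ≤ (1 / ((n : ℝ) + 1)) • u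

namespace IsRULimit

variable {T : E →ₗ[ℝ] F} {x x' : RUCompletion E} {y y' : F}

/-- The limit does not depend on the sequence, because `T` maps null sequences to null sequences. -/
theorem unique (hT : IsVLHom ℝ abs abs T) (h : IsRULimit T x y) (h' : IsRULimit T x y') :
    y = y' := by
  obtain ⟨a, rfl, u, hu⟩ := h
  obtain ⟨b, hb, v, hv⟩ := h'
  obtain ⟨w, hw⟩ := mk_eq_mk.mp hb
  refine sub_eq_zero.mp (eq_zero_of_abs_le (u := u + T w + v) fun n => ?_)
  have h1 := hT.mono (hw n)
  rw [hT, map_sub, map_smul] at h1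
  have h2 := hu n
  rw [abs_sub_comm] at h1 h2
  calc |y - y'| = |(y - T (a.1 n)) + (T (a.1 n) - T (b.1 n)) + (T (b.1 n) - y')| := by
        congr 1
        abel
    _ ≤ _ := (abs_add_le _ _).trans (add_le_add (abs_add_le _ _) le_rfl)
    _ ≤ _ := add_le_add (add_le_add h2 h1) (hv n)
    _ = _ := by module

theorem of (T : E →ₗ[ℝ] F) (e : E) : IsRULimit T (RUCompletion.of E e) (T e) := by
  refine ⟨_, rfl, 0, fun n => ?_⟩
  change |T e - T e| ≤ _
  simp

theorem add (h : IsRULimit T x y) (h' : IsRULimit T x' y') :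
    IsRULimit T (x + x') (y + y') := by
  obtain ⟨a, rfl, u, hu⟩ := h
  obtain ⟨b, rfl, v, hv⟩ := h'
  refine ⟨a + b, map_add _ _ _, u + v, fun n => ?_⟩
  change |T (a.1 n + b.1 n) - _| ≤ _
  rw [map_add, add_sub_add_comm, smul_add]
  exact (abs_add_le _ _).trans (add_le_add (hu n) (hv n))

theorem smul (r : ℝ) (h : IsRULimit T x y) : IsRULimit T (r • x) (r • y) := by
  obtain ⟨a, rfl, u, hu⟩ := h
  refine ⟨r • a, map_smul _ _ _, |r| • u, fun n => ?_⟩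
  change |T (r • a.1 n) - _| ≤ _
  rw [map_smul, ← smul_sub, abs_smul_vl, smul_comm]
  exact smul_le_smul_of_nonneg_left (hu n) (abs_nonneg r)

theorem modulus (hT : IsVLHom ℝ abs abs T) (h : IsRULimit T x y) :
    IsRULimit T (RUCompletion.modulus x) |y| := by
  obtain ⟨a, rfl, u, hu⟩ := h
  refine ⟨seqAbs a, rfl, u, fun n => ?_⟩
  change |T |a.1 n| - _| ≤ _
  rw [hT]
  exact (abs_abs_sub_abs_le _ _).trans (hu n)

theorem box (hT : IsVLHom ℝ abs abs T) (h : IsRULimit T x y) (h' : IsRULimit T x' y')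
    {s : RUCompletion E} {t : F} (hs : IsBoxPlus RUCompletion.modulus x x' s)
    (ht : IsBoxPlus abs y y' t) : IsRULimit T s t := by
  obtain ⟨a, rfl, u, hu⟩ := h
  obtain ⟨b, rfl, v, hv⟩ := h'
  refine ⟨seqBox a b, (isBoxPlus_mk a b).unique' RUCompletion.isArchimedeanModulus hs,
    (u + v) + (7 : ℝ) • (|y| + |y'|), fun n => ?_⟩
  change |T (boxApprox n (a.1 n) (b.1 n)) - t| ≤ _
  rw [hT.map_boxApprox]
  obtain ⟨h1, h2⟩ := isBoxPlus_iff_boxApprox.mp ht n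
  have hd := add_le_add (hu n) (hv n)
  have h3 := boxApprox_le_add n (T (a.1 n)) (T (b.1 n)) y y'
  have h4 := boxApprox_le_add n y y' (T (a.1 n)) (T (b.1 n))
  rw [abs_sub_comm, abs_sub_comm y'] at h4
  have h0 : 0 ≤ (1 / ((n : ℝ) + 1)) • ((7 : ℝ) • (|y| + |y'|)) :=
    smul_nonneg (one_div_succ_nonneg n)
      (smul_nonneg (by norm_num) (add_nonneg (abs_nonneg _) (abs_nonneg _)))
  rw [smul_add, smul_add]
  refine abs_sub_le_iff_vl.mpr ⟨?_, ?_⟩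
  · exact h3.trans (add_le_add h1 (hd.trans (le_add_of_nonneg_right h0)))
  · rw [← add_assoc]
    exact h2.trans (add_le_add_left (h4.trans (add_le_add_right hd _)) _)

end IsRULimit

/-- On the square mean hull the limits exist in `F`, although `F` need not be relatively uniformly
complete. -/
theorem exists_isRULimit {T : E →ₗ[ℝ] F} (hT : IsVLHom ℝ abs abs T)
    (hF : IsSquareMeanComplete (abs : F → F)) {x : RUCompletion E}
    (hx : MemSquareMeanHull x) : ∃ y, IsRULimit T x y := by
  induction hx with
  | of e => exact ⟨_, .of T e⟩
  | add _ _ ihx ihy =>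
    obtain ⟨y, hy⟩ := ihx
    obtain ⟨y', hy'⟩ := ihy
    exact ⟨_, hy.add hy'⟩
  | smul r _ ih =>
    obtain ⟨y, hy⟩ := ih
    exact ⟨_, hy.smul r⟩
  | modulus _ ih =>
    obtain ⟨y, hy⟩ := ih
    exact ⟨_, hy.modulus hT⟩
  | box _ _ hs ihx ihy =>
    obtain ⟨y, hy⟩ := ihx
    obtain ⟨y', hy'⟩ := ihy
    exact ⟨_, hy.box hT hy' hs (hF.isBoxPlus y y')⟩

/-- Homomorphisms into square mean complete vector lattices extend to the square mean hull. -/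
theorem exists_squareMeanHull_extension {T : E →ₗ[ℝ] F} (hT : IsVLHom ℝ abs abs T)
    (hF : IsSquareMeanComplete (abs : F → F)) :
    ∃ S : squareMeanHull E →ₗ[ℝ] F, IsVLHom ℝ (squareMeanHullModulus E) abs S ∧
      ∀ e, S (toSquareMeanHull E e) = T e := by
  choose S hS using fun x : squareMeanHull E => exists_isRULimit hT hF x.2
  exact ⟨{ toFun := S
           map_add' := fun x y => (hS (x + y)).unique hT ((hS x).add (hS y))
           map_smul' := fun r x => (hS (r • x)).unique hT ((hS x).smul r) },
    fun x => (hS (squareMeanHullModulus E x)).unique hT ((hS x).modulus hT),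
    fun e => (hS (toSquareMeanHull E e)).unique hT (.of T e)⟩

end Extension

theorem isSquareMeanCompletion_squareMeanHull : IsSquareMeanCompletion.{u, u, w} (abs : E → E)
    (squareMeanHullModulus E) (toSquareMeanHull E) where
  modulus := isArchimedeanModulus_squareMeanHull
  complete := isSquareMeanComplete_squareMeanHull
  hom _ := rfl
  injective _ _ h := of_injective (congrArg Subtype.val h)
  universal F _ _ mF hF hC T hT := by
    refine existsUnique_of_exists_of_unique ?_ fun S S' hS hS' =>
      squareMeanHull_hom_ext hF hS.1 hS'.1 fun e => (hS.2 e).trans (hS'.2 e).symm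
    obtain ⟨_, _, rfl⟩ := hF.exists_lattice
    exact exists_squareMeanHull_extension hT hC

end SquareMeanHull

theorem exists_isSquareMeanCompletion {E : Type u} [AddCommGroup E] [Module ℝ E] {mE : E → E}
    (hE : IsArchimedeanModulus ℝ mE) :
    ∃ (M : Type u) (_ : AddCommGroup M) (_ : Module ℝ M) (mM : M → M) (φ : E →ₗ[ℝ] M),
      IsSquareMeanCompletion.{u, u, w} mE mM φ := by
  obtain ⟨_, _, rfl⟩ := hE.exists_lattice
  exact ⟨squareMeanHull E, inferInstance, inferInstance, squareMeanHullModulus E,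
    toSquareMeanHull E, isSquareMeanCompletion_squareMeanHull⟩

end

theorem theorem3p3 {E : Type u} [AddCommGroup E] [Module ℝ E] (mE : E → E)
    (hE : IsArchimedeanModulus ℝ mE) :
    -- existence
    (∃ (C : Type u) (_ : AddCommGroup C) (_ : Module ℂ C) (mC : C → C) (φ : E →ₗ[ℝ] C),
      IsVLComplexification.{u, u, w} mE mC φ) ∧
    -- uniqueness
    (∀ (C₁ C₂ : Type w) [AddCommGroup C₁] [Module ℂ C₁] [AddCommGroup C₂] [Module ℂ C₂]
      (m₁ : C₁ → C₁) (m₂ : C₂ → C₂) (φ₁ : E →ₗ[ℝ] C₁) (φ₂ : E →ₗ[ℝ] C₂),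
      IsVLComplexification.{u, w, w} mE m₁ φ₁ → IsVLComplexification.{u, w, w} mE m₂ φ₂ →
      ∃! γ : C₁ ≃ₗ[ℂ] C₂, IsVLHom ℂ m₁ m₂ γ.toLinearMap ∧ ∀ f, γ (φ₁ f) = φ₂ f) ∧
    -- construction from the square mean completion, which exists
    (∃ (M : Type u) (_ : AddCommGroup M) (_ : Module ℝ M) (mM : M → M) (φ : E →ₗ[ℝ] M),
      IsSquareMeanCompletion.{u, u, w} mE mM φ) ∧
    (∀ (M : Type v) [AddCommGroup M] [Module ℝ M] (mM : M → M) (φ : E →ₗ[ℝ] M),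
      IsSquareMeanCompletion.{u, v, w} mE mM φ →
      IsVLComplexification.{u, v, w} mE (VSComplexification.modulus mM)
        (VSComplexification.ofReal ∘ₗ φ)) := by
  obtain ⟨M, _, _, mM, φ, h⟩ := exists_isSquareMeanCompletion.{u, w} hE
  exact ⟨⟨VSComplexification M, inferInstance, inferInstance, _, _, h.isVLComplexification⟩,
    fun C₁ C₂ _ _ _ _ m₁ m₂ φ₁ φ₂ h₁ h₂ => h₁.existsUnique_equiv h₂,
    ⟨M, inferInstance, inferInstance, mM, φ, h⟩,
    fun M _ _ mM φ h => h.isVLComplexification⟩
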